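/- Let $\mathfrak{gl}_\infty$ be the complex Lie algebra, under the commutator bracket, of all matrices $(a_{ij})_{i,j\in\mathbb Z}$ with only finitely many nonzero entries; it has basis the matrix units $E_{m,n}$ $(m,n\in\mathbb Z)$. Put $H=\mathrm{span}\{E_{n,n}\mid n\in\mathbb Z\}$. A $\mathfrak{gl}_\infty$-module $W$ over $\mathbb C$ is *integrable* if every $E_{n,n}$ acts semisimply (i.e. diagonalizably) on $W$ and every $E_{p,q}$ with $p\neq q$ acts locally nilpotently on $W$. Let $\mathcal C$ be the category of $\mathfrak{gl}_\infty$-modules $W$ such that for every $w\in W$ there is a finite set $T\subset\mathbb Z$ with $E_{m,n}w=0$ for all $m,n\in\mathbb Z$ with $n\notin T$, and let $\mathcal C_{int}$ be the full subcategory of integrable modules in $\mathcal C$. For a finite nonempty set $S\subset\mathbb Z$ put $\mathfrak{gl}_S=\mathrm{span}\{E_{m,n}\mid m,n\in S\}$ and $\mathfrak{gl}_\infty^{(S,+)}=\mathrm{span}\{E_{m,n}\mid m\in\mathbb Z,\ n\notin S\}$. For $\lambda\in H^*$ with $\lambda(E_{i,i})=0$ for all $i\notin S$, let $L(\lambda_S)$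 be the irreducible quotient of the Verma $\mathfrak{gl}_S$-module with highest weight $\lambda_S=\lambda|_{H\cap\mathfrak{gl}_S}$ (with respect to the positive part $\mathrm{span}\{E_{m,n}\mid m,n\in S,\ m<n\}$). Let $\mathfrak{gl}_\infty^{(S,+)}$ act on $L(\lambda_S)$ by zero, form the induced module $$M(S,L(\lambda_S))=U(\mathfrak{gl}_\infty)\otimes_{U(\mathfrak{gl}_\infty^{(S,+)}+\mathfrak{gl}_S)}L(\lambda_S),$$ and let $L(S,\lambda)$ be its irreducible quotient, i.e. its quotient by the sum of all its proper submodules. Let $P_+(S)$ be the set of $\lambda\in H^*$ such that $\lambda(E_{i,i})\in\mathbb N=\{0,1,2,\dots\}$ for all $i\in\mathbb Z$, $\lambda(E_{i,i})=0$ for $i\notin S$, and $\lambda(E_{i,i})\ge\lambda(E_{j,j})$ for all $i,j\in S$ with $i<j$. **Theorem.** (1) Let $S=\{r,r+1,\dots,n\}$ where $r<n$ are integers, and let $\lambda\in P_+(S)$. Then $L(S,\lambda)$ is irreducible and belongs to $\mathcal C_{int}$. (2) Every irreducible $\mathfrak{gl}_\infty$-module in $\mathcal C_{int}$ is isomorphic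 to $L(S,\lambda)$ for some $S=\{r,r+1,\dots,n\}$ with integers $r<n$ and some $\lambda\in P_+(S)$. -/

import Mathlib

open scoped TensorProduct

noncomputable section

namespace GlInf

/-! ### The Lie algebra `gl_∞` -/

section Algebra

attribute [local instance 100] LieRing.ofAssociativeRing

/-- `ℂ^∞`: doubly infinite column vectors with finitely many nonzero entries. -/
abbrev CInf : Type := ℤ →₀ ℂ

/-- The matrix unit with a single nonzero entry `1` in position `(m, n)`, as the operator
`v_k ↦ δ_{n,k} v_m` on `ℂ^∞`. -/
def matUnit (m n : ℤ) : Module.End ℂ CInf :=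
  (Finsupp.lsingle m : ℂ →ₗ[ℂ] CInf) ∘ₗ (Finsupp.lapply n : CInf →ₗ[ℂ] ℂ)

lemma matUnit_mul (m n r s : ℤ) :
    matUnit m n * matUnit r s = if n = r then matUnit m s else 0 := by
  ext k l
  by_cases h : n = r
  · subst h
    simp [matUnit]
  · simp [matUnit, h, Finsupp.single_apply]

lemma matUnit_comm (m n r s : ℤ) :
    matUnit m n * matUnit r s - matUnit r s * matUnit m n =
      (if n = r then matUnit m s else 0) - (if m = s then matUnit r n else 0) := by
  rw [matUnit_mul, matUnit_mul]
  simp only [eq_comm]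

/-- If brackets of elements of a generating set lie in its span, then the span is closed under
the bracket. -/
lemma lie_mem_span {g : Type*} [LieRing g] [LieAlgebra ℂ g] {s : Set g}
    (h : ∀ x ∈ s, ∀ y ∈ s, ⁅x, y⁆ ∈ Submodule.span ℂ s) {x y : g}
    (hx : x ∈ Submodule.span ℂ s) (hy : y ∈ Submodule.span ℂ s) :
    ⁅x, y⁆ ∈ Submodule.span ℂ s := by
  induction hx, hy using Submodule.span_induction₂ with
  | mem_mem x y hx hy => exact h x hx y hy
  | zero_left y hy => simp
  | zero_right x hx => simp
  | add_left x y z _ _ _ h₁ h₂ => rw [add_lie]; exact add_mem h₁ h₂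
  | add_right x y z _ _ _ h₁ h₂ => rw [lie_add]; exact add_mem h₁ h₂
  | smul_left c x y _ _ h₁ => rw [smul_lie]; exact Submodule.smul_mem _ _ h₁
  | smul_right c x y _ _ h₁ => rw [lie_smul]; exact Submodule.smul_mem _ _ h₁

/-- `gl_∞`: the doubly infinite complex matrices with finitely many nonzero entries (the span of
the matrix units), under the commutator bracket. -/
def glInf : LieSubalgebra ℂ (Module.End ℂ CInf) where
  toSubmodule := Submodule.span ℂ {x | ∃ m n : ℤ, x = matUnit m n}
  lie_mem' := by
    intro x y hx hy
    refine lie_mem_span ?_ hx hy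
    rintro _ ⟨m, n, rfl⟩ _ ⟨r, s, rfl⟩
    rw [LieRing.of_associative_ring_bracket, matUnit_comm]
    refine Submodule.sub_mem _ ?_ ?_ <;> split_ifs
    · exact Submodule.subset_span ⟨_, _, rfl⟩
    · exact Submodule.zero_mem _
    · exact Submodule.subset_span ⟨_, _, rfl⟩
    · exact Submodule.zero_mem _

/-- The canonical basis vectors `E_{m,n}` of `gl_∞`. -/
def E (m n : ℤ) : glInf := ⟨matUnit m n, Submodule.subset_span ⟨m, n, rfl⟩⟩

lemma lie_E (m n r s : ℤ) :
    ⁅E m n, E r s⁆ = (if n = r then E m s else 0) - (if m = s then E r n else 0) := by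
  apply Subtype.ext
  change matUnit m n * matUnit r s - matUnit r s * matUnit m n = _
  rw [matUnit_comm]
  split_ifs <;> rfl

end Algebra

/-- The Cartan subalgebra `H = span {E_{n,n}}`. -/
def H : Submodule ℂ glInf := Submodule.span ℂ {x | ∃ n : ℤ, x = E n n}

/-- `E_{n,n}` as an element of `H`. -/
def EH (n : ℤ) : H := ⟨E n n, Submodule.subset_span ⟨n, rfl⟩⟩

/-- `gl_S = span {E_{m,n} | m, n ∈ S}`. -/
def glS (S : Finset ℤ) : LieSubalgebra ℂ glInf where
  toSubmodule := Submodule.span ℂ {x | ∃ m ∈ S, ∃ n ∈ S, x = E m n}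
  lie_mem' := by
    intro x y hx hy
    refine lie_mem_span ?_ hx hy
    rintro _ ⟨m, hm, n, hn, rfl⟩ _ ⟨r, hr, s, hs, rfl⟩
    rw [lie_E]
    refine Submodule.sub_mem _ ?_ ?_ <;> split_ifs
    · exact Submodule.subset_span ⟨_, hm, _, hs, rfl⟩
    · exact Submodule.zero_mem _
    · exact Submodule.subset_span ⟨_, hr, _, hn, rfl⟩
    · exact Submodule.zero_mem _

/-- `E_{m,n}` as an element of `gl_S`, for `m, n ∈ S`. -/
def ES {S : Finset ℤ} {m n : ℤ} (hm : m ∈ S) (hn : n ∈ S) : glS S :=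
  ⟨E m n, Submodule.subset_span ⟨m, hm, n, hn, rfl⟩⟩

/-- `gl_∞^{(S,+)} = span {E_{m,n} | m ∈ ℤ, n ∉ S}`. -/
def glPlus (S : Finset ℤ) : Submodule ℂ glInf :=
  Submodule.span ℂ {x | ∃ m n : ℤ, n ∉ S ∧ x = E m n}

/-! ### Categories of `gl_∞`-modules -/

section Categories

variable (W : Type*) [AddCommGroup W] [Module ℂ W] [LieRingModule glInf W] [LieModule ℂ glInf W]

/-- `W` belongs to the category `𝒞`: every `w ∈ W` is annihilated by all `E_{m,n}` with
`n` outside some finite set. -/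
def InC : Prop :=
  ∀ w : W, ∃ S : Finset ℤ, ∀ m n : ℤ, n ∉ S → ⁅E m n, w⁆ = 0

/-- `W` is integrable: every `E_{n,n}` is semisimple (`W` is the sum of its eigenspaces) and every
`E_{p,q}` with `p ≠ q` is locally nilpotent. -/
structure IsIntegrable : Prop where
  semisimple : ∀ n : ℤ,
    ⨆ μ : ℂ, Module.End.eigenspace (LieModule.toEnd ℂ glInf W (E n n)) μ = ⊤
  locallyNilpotent : ∀ p q : ℤ, p ≠ q → ∀ w : W, ∃ k : ℕ,
    (LieModule.toEnd ℂ glInf W (E p q) ^ k) w = 0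

/-- `W` belongs to the category `𝒞_int` of integrable modules in `𝒞`. -/
structure InCint : Prop where
  inC : InC W
  integrable : IsIntegrable W

end Categories

/-! ### Lie modules from modules over the enveloping algebra, and irreducible quotients -/

section General

variable (g : Type*) [LieRing g] [LieAlgebra ℂ g] (M : Type*) [AddCommGroup M]

/-- A left `U(g)`-module is a `g`-module through `ι : g → U(g)`. -/
@[reducible]
def lieRingModuleOfUEA [Module (UniversalEnvelopingAlgebra ℂ g) M] : LieRingModule g M where
  bracket x m := UniversalEnvelopingAlgebra.ι ℂ x • m
  add_lie x y m := by
    rw [map_add, add_smul]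
  lie_add x m n := smul_add _ m n
  leibniz_lie x y m := by
    change _ • _ • m = UniversalEnvelopingAlgebra.ι ℂ ⁅x, y⁆ • m + _ • _ • m
    let _ : LieRing (UniversalEnvelopingAlgebra ℂ g) := LieRing.ofAssociativeRing
    rw [LieHom.map_lie, LieRing.of_associative_ring_bracket, sub_smul, mul_smul, mul_smul]
    abel

lemma lieModuleOfUEA [Module ℂ M] [Module (UniversalEnvelopingAlgebra ℂ g) M]
    [IsScalarTower ℂ (UniversalEnvelopingAlgebra ℂ g) M] :
    let _ := lieRingModuleOfUEA g M
    LieModule ℂ g M := by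
  let _ := lieRingModuleOfUEA g M
  refine ⟨fun t x m => ?_, fun t x m => ?_⟩
  · change UniversalEnvelopingAlgebra.ι ℂ (t • x) • m = t • UniversalEnvelopingAlgebra.ι ℂ x • m
    rw [map_smul, smul_assoc]
  · change UniversalEnvelopingAlgebra.ι ℂ x • t • m = t • UniversalEnvelopingAlgebra.ι ℂ x • m
    rw [← algebraMap_smul (UniversalEnvelopingAlgebra ℂ g) t m, ← mul_smul,
      ← Algebra.commutes, mul_smul, algebraMap_smul]

/-- The quotient of a `g`-module by the sum of its proper submodules. If there is a unique maximal
proper submodule containing all proper ones, as for highest weight modules, this is the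
irreducible quotient. -/
abbrev IrrQuotient [Module ℂ M] [LieRingModule g M] [LieModule ℂ g M] : Type _ :=
  M ⧸ sSup {N : LieSubmodule ℂ g M | N ≠ ⊤}

end General

/-! ### Verma modules for `gl_S` and generalized Verma modules for `gl_∞` -/

section Verma

variable (S : Finset ℤ) (lam : Module.Dual ℂ H)

/-- The left ideal of `U(gl_S)` generated by `E_{m,n}` (`m < n` in `S`) and by
`E_{n,n} - λ(E_{n,n})` (`n ∈ S`). -/
def vermaIdeal : Submodule (UniversalEnvelopingAlgebra ℂ (glS S))
    (UniversalEnvelopingAlgebra ℂ (glS S)) :=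
  Submodule.span _
    ({a | ∃ (m n : ℤ) (hm : m ∈ S) (hn : n ∈ S), m < n ∧
        a = UniversalEnvelopingAlgebra.ι ℂ (ES hm hn)} ∪
     {a | ∃ (n : ℤ) (hn : n ∈ S),
        a = UniversalEnvelopingAlgebra.ι ℂ (ES hn hn) - algebraMap ℂ _ (lam (EH n))})

/-- The Verma `gl_S`-module `M(λ_S)` of highest weight `λ|_{H_S}`. -/
def Verma : Type := UniversalEnvelopingAlgebra ℂ (glS S) ⧸ vermaIdeal S lam

instance : AddCommGroup (Verma S lam) :=
  inferInstanceAs (AddCommGroup (UniversalEnvelopingAlgebra ℂ (glS S) ⧸ vermaIdeal S lam))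

instance : Module (UniversalEnvelopingAlgebra ℂ (glS S)) (Verma S lam) :=
  inferInstanceAs (Module _ (UniversalEnvelopingAlgebra ℂ (glS S) ⧸ vermaIdeal S lam))

instance : Module ℂ (Verma S lam) :=
  inferInstanceAs (Module ℂ (UniversalEnvelopingAlgebra ℂ (glS S) ⧸ vermaIdeal S lam))

instance : IsScalarTower ℂ (UniversalEnvelopingAlgebra ℂ (glS S)) (Verma S lam) :=
  inferInstanceAs (IsScalarTower ℂ _ (UniversalEnvelopingAlgebra ℂ (glS S) ⧸ vermaIdeal S lam))

instance : LieRingModule (glS S) (Verma S lam) := lieRingModuleOfUEA _ _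

instance : LieModule ℂ (glS S) (Verma S lam) := lieModuleOfUEA _ _

/-- `L(λ_S)`, the irreducible highest weight `gl_S`-module of highest weight `λ|_{H_S}`. -/
abbrev LS : Type := IrrQuotient (glS S) (Verma S lam)

variable (U : Type*) [AddCommGroup U] [Module ℂ U] [LieRingModule (glS S) U]
  [LieModule ℂ (glS S) U]

/-- The `U(gl_∞)`-submodule of `U(gl_∞) ⊗_ℂ U` generated by `x ⊗ u - 1 ⊗ x u` for `x` in
`gl_∞^{(S,+)} + gl_S`, where `gl_∞^{(S,+)}` acts on `U` by zero. The quotient is the tensor product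
over `U(gl_∞^{(S,+)} + gl_S)`. -/
def genVermaRel : Submodule (UniversalEnvelopingAlgebra ℂ glInf)
    (UniversalEnvelopingAlgebra ℂ glInf ⊗[ℂ] U) :=
  Submodule.span _
    ({a | ∃ (x : glS S) (u : U),
        a = UniversalEnvelopingAlgebra.ι ℂ (x : glInf) ⊗ₜ[ℂ] u - 1 ⊗ₜ[ℂ] ⁅x, u⁆} ∪
     {a | ∃ x ∈ glPlus S, ∃ u : U, a = UniversalEnvelopingAlgebra.ι ℂ x ⊗ₜ[ℂ] u})

/-- The generalized Verma module
`M(S, U) = U(gl_∞) ⊗_{U(gl_∞^{(S,+)} + gl_S)} U`. -/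
def GenVerma : Type _ := (UniversalEnvelopingAlgebra ℂ glInf ⊗[ℂ] U) ⧸ genVermaRel S U

instance : AddCommGroup (GenVerma S U) :=
  inferInstanceAs (AddCommGroup ((UniversalEnvelopingAlgebra ℂ glInf ⊗[ℂ] U) ⧸ genVermaRel S U))

instance : Module (UniversalEnvelopingAlgebra ℂ glInf) (GenVerma S U) :=
  inferInstanceAs (Module _ ((UniversalEnvelopingAlgebra ℂ glInf ⊗[ℂ] U) ⧸ genVermaRel S U))

instance : Module ℂ (GenVerma S U) :=
  inferInstanceAs (Module ℂ ((UniversalEnvelopingAlgebra ℂ glInf ⊗[ℂ] U) ⧸ genVermaRel S U))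

instance : IsScalarTower ℂ (UniversalEnvelopingAlgebra ℂ glInf) (GenVerma S U) :=
  inferInstanceAs (IsScalarTower ℂ _
    ((UniversalEnvelopingAlgebra ℂ glInf ⊗[ℂ] U) ⧸ genVermaRel S U))

instance : LieRingModule glInf (GenVerma S U) := lieRingModuleOfUEA _ _

instance : LieModule ℂ glInf (GenVerma S U) := lieModuleOfUEA _ _

/-- `L(S, λ)`, the irreducible quotient of `M(S, L(λ_S))`. -/
abbrev L : Type := IrrQuotient glInf (GenVerma S (LS S lam))

/-- `P_+(S)`: the `λ ∈ H^*` with `λ(E_{i,i}) ∈ ℕ` for all `i`, vanishing for `i ∉ S`, and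
weakly decreasing on `S`. -/
def PPlus : Set (Module.Dual ℂ H) :=
  {lam | ∃ a : ℤ → ℕ, (∀ i, lam (EH i) = (a i : ℂ)) ∧ (∀ i, i ∉ S → a i = 0) ∧
    ∀ i ∈ S, ∀ j ∈ S, i < j → a j ≤ a i}

end Verma

end GlInf

end

/-!
Grade a highest weight module by the eigenvalues of a diagonal matrix `D` for which every matrix
unit either has positive degree or preserves the line through the highest weight vector `v`. Then
`v` spans the lowest degree and every proper submodule lives in higher degrees. So there is a
largest proper submodule, and any homomorphism to an irreducible module that is nonzero on `v`
has it as its kernel. This applies to Verma modules of `gl_S` and to `M(S, L(λ_S))`.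

An irreducible module with a nonzero highest weight vector `v` killed by `gl_∞^{(S,+)}` is a
quotient of `M(S, L(λ_S))`: for the grading by minus the identity matrix of `gl_S`, the vectors of
the degree of `v` killed by `gl_∞^{(S,+)}` form an irreducible `gl_S`-module.

In an integrable module, the weights of vectors killed by `gl_∞^{(S,+)}` are natural numbers, by
`sl_2`-theory for the pairs `(i, p)` with `p ∉ S`. Hence raising operators can be applied only
finitely often, which produces a highest weight vector; its weight is dominant by `sl_2`-theory for
pairs in `S`.

Conversely, every `λ ∈ P_+(S)` is the weight of a product of powers of leading principal minors in
the polynomial ring in the entries of a matrix, on which `gl_∞` acts by derivations. This module is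
integrable, and `L(S, λ)` is a subquotient of it.
-/

noncomputable section

namespace GlInf

section Eigen

variable {K V V' : Type*} [Field K] [AddCommGroup V] [Module K V] [AddCommGroup V'] [Module K V']

lemma map_eigenspace_le {f : Module.End K V} {f' : Module.End K V'} {φ : V →ₗ[K] V'}
    (hφ : ∀ v, φ (f v) = f' (φ v)) (μ : K) : (f.eigenspace μ).map φ ≤ f'.eigenspace μ := by
  rintro _ ⟨v, hv, rfl⟩
  rw [Module.End.mem_eigenspace_iff, ← hφ, Module.End.mem_eigenspace_iff.mp hv, map_smul]

lemma mem_of_sum_mem_of_mem_eigenspace {f : Module.End K V} {p : Submodule K V}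
    (hp : p ∈ f.invtSubmodule) {x : K →₀ V} (hx : ∀ μ, x μ ∈ f.eigenspace μ)
    (hsum : x.sum (fun _ v => v) ∈ p) (μ : K) : x μ ∈ p := by
  let f' : Module.End K (V ⧸ p) := p.mapQ p f hp
  have hmap (ν : K) : p.mkQ (x ν) ∈ f'.eigenspace ν :=
    map_eigenspace_le (φ := p.mkQ) (fun _ => rfl) ν (Submodule.mem_map_of_mem (hx ν))
  by_cases hμ : μ ∈ x.support
  · have hzero : ∑ ν ∈ x.support, p.mkQ (x ν) = 0 := by
      rw [← map_sum]
      exact (Submodule.Quotient.mk_eq_zero p).mpr hsum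
    exact (Submodule.Quotient.mk_eq_zero p).mp
      ((iSupIndep_iff_finsetSum_eq_zero_imp_eq_zero _).mp
        f'.eigenspaces_iSupIndep x.support _ (fun ν _ => hmap ν) hzero μ hμ)
  · rw [Finsupp.notMem_support_iff.mp hμ]
    exact p.zero_mem

lemma le_iSup_inf_eigenspace {f : Module.End K V} (hf : ⨆ μ, f.eigenspace μ = ⊤)
    {p : Submodule K V} (hp : p ∈ f.invtSubmodule) : p ≤ ⨆ μ, p ⊓ f.eigenspace μ := by
  intro x hx
  have hx' : x ∈ ⨆ μ, f.eigenspace μ := hf ▸ Submodule.mem_top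
  obtain ⟨y, hy, rfl⟩ := (Submodule.mem_iSup_iff_exists_finsupp _ _).mp hx'
  exact Submodule.sum_mem _ fun μ _ => Submodule.mem_iSup_of_mem μ
    ⟨mem_of_sum_mem_of_mem_eigenspace hp hy hx μ, hy μ⟩

lemma exists_mem_eigenspace_ne_zero {f : Module.End K V} (hf : ⨆ μ, f.eigenspace μ = ⊤)
    {p : Submodule K V} (hp : p ∈ f.invtSubmodule) (hp0 : p ≠ ⊥) :
    ∃ μ : K, ∃ y ∈ p, y ≠ 0 ∧ f y = μ • y := by
  by_contra! h
  refine hp0 (le_bot_iff.mp ((le_iSup_inf_eigenspace hf hp).trans (iSup_le fun μ y hy => ?_)))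
  by_contra hy0
  exact h μ y hy.1 hy0 (Module.End.mem_eigenspace_iff.mp hy.2)

lemma exists_mem_forall_apply_eq_smul {ι : Type*} {f : ι → Module.End K V}
    (hf : ∀ i, ⨆ μ, (f i).eigenspace μ = ⊤) (hcomm : ∀ i j, Commute (f i) (f j))
    {p : Submodule K V} (hp : ∀ i, p ∈ (f i).invtSubmodule) (hp0 : p ≠ ⊥) (s : Finset ι) :
    ∃ μ : ι → K, ∃ y ∈ p, y ≠ 0 ∧ ∀ i ∈ s, f i y = μ i • y := by
  classical
  induction s using Finset.induction_on with
  | empty =>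
    obtain ⟨y, hy, hy0⟩ := p.exists_mem_ne_zero_of_ne_bot hp0
    exact ⟨0, y, hy, hy0, fun i hi => absurd hi (Finset.notMem_empty i)⟩
  | insert j s hj ih =>
    obtain ⟨μ, y, hy, hy0, hys⟩ := ih
    let q : Submodule K V := p ⊓ ⨅ i ∈ s, (f i).eigenspace (μ i)
    have mem_q {x : V} : x ∈ q ↔ x ∈ p ∧ ∀ i ∈ s, f i x = μ i • x := by
      simp only [q, Submodule.mem_inf, Submodule.mem_iInf, Module.End.mem_eigenspace_iff]
    have hq : q ∈ (f j).invtSubmodule := fun x hx => mem_q.mpr ⟨hp j (mem_q.mp hx).1, fun i hi => by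
      rw [← Module.End.mul_apply, (hcomm i j).eq, Module.End.mul_apply, (mem_q.mp hx).2 i hi,
        map_smul]⟩
    obtain ⟨ν, z, hz, hz0, hzj⟩ := exists_mem_eigenspace_ne_zero (hf j) hq
      ((Submodule.ne_bot_iff q).mpr ⟨y, mem_q.mpr ⟨hy, hys⟩, hy0⟩)
    refine ⟨Function.update μ j ν, z, (mem_q.mp hz).1, hz0, fun i hi => ?_⟩
    rcases Finset.mem_insert.mp hi with rfl | hi
    · rw [Function.update_self, hzj]
    · rw [Function.update_of_ne (ne_of_mem_of_not_mem hi hj), (mem_q.mp hz).2 i hi]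

lemma iSup_eigenspace_eq_top_of_surjective {f : Module.End K V} {f' : Module.End K V'}
    (hf : ⨆ μ, f.eigenspace μ = ⊤) {φ : V →ₗ[K] V'} (hφ : ∀ v, φ (f v) = f' (φ v))
    (hsurj : Function.Surjective φ) : ⨆ μ, f'.eigenspace μ = ⊤ := by
  rw [eq_top_iff, ← LinearMap.range_eq_top.mpr hsurj, ← Submodule.map_top, ← hf,
    Submodule.map_iSup]
  exact iSup_mono fun μ => map_eigenspace_le hφ μ

lemma iSup_eigenspace_eq_top_of_injective {f : Module.End K V} {f' : Module.End K V'}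
    (hf' : ⨆ μ, f'.eigenspace μ = ⊤) {φ : V →ₗ[K] V'} (hφ : ∀ v, φ (f v) = f' (φ v))
    (hinj : Function.Injective φ) : ⨆ μ, f.eigenspace μ = ⊤ := by
  have hrange : LinearMap.range φ ∈ f'.invtSubmodule := by
    rintro _ ⟨v, rfl⟩
    exact ⟨f v, hφ v⟩
  have hle (μ : K) : LinearMap.range φ ⊓ f'.eigenspace μ ≤ (f.eigenspace μ).map φ := by
    rintro _ ⟨⟨v, rfl⟩, hv⟩
    refine ⟨v, Module.End.mem_eigenspace_iff.mpr (hinj ?_), rfl⟩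
    rw [hφ, Module.End.mem_eigenspace_iff.mp hv, map_smul]
  refine Submodule.map_injective_of_injective hinj (le_antisymm (Submodule.map_mono le_top) ?_)
  rw [Submodule.map_top, Submodule.map_iSup]
  exact (le_iSup_inf_eigenspace hf' hrange).trans (iSup_mono hle)

end Eigen

section Stabilizer

variable {R g M : Type*} [CommRing R] [LieRing g] [LieAlgebra R g]
  [AddCommGroup M] [Module R M] [LieRingModule g M] [LieModule R g M]

variable (g) in
/-- The elements `x` of the Lie algebra with `⁅x, P⁆ ⊆ P`. -/
def stabilizer (P : Submodule R M) : Submodule R g :=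
  (P.compatibleMaps P).comap (LieModule.toEnd R g M : g →ₗ[R] Module.End R M)

lemma mem_stabilizer {P : Submodule R M} {x : g} :
    x ∈ stabilizer g P ↔ ∀ m ∈ P, ⁅x, m⁆ ∈ P := Iff.rfl

/-- In terms of enveloping algebras, `U(g) P = U(n) P`; the proof avoids the PBW theorem. -/
lemma lieSpan_le_of_stabilizer_sup_eq_top {P Q : Submodule R M} {n : Submodule R g}
    (hn : stabilizer g P ⊔ n = ⊤) (hPQ : P ≤ Q) (hQ : n ≤ stabilizer g Q) :
    (LieSubmodule.lieSpan R g (P : Set M)).toSubmodule ≤ Q := by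
  -- The smallest `n`-stable submodule `Q₀` containing `P` is stable under all of `g`: the largest
  -- submodule of `Q₀` that `g` maps into `Q₀` contains `P` and is `n`-stable.
  let Q₀ : Submodule R M := sInf {Q | P ≤ Q ∧ n ≤ stabilizer g Q}
  have hP₀ : P ≤ Q₀ := le_sInf fun _ h => h.1
  have hn₀ {z : g} (hz : z ∈ n) {m : M} (hm : m ∈ Q₀) : ⁅z, m⁆ ∈ Q₀ :=
    Submodule.mem_sInf.mpr fun Q' h => mem_stabilizer.mp (h.2 hz) _ (Submodule.mem_sInf.mp hm Q' h)
  let Q₁ : Submodule R M := Q₀ ⊓ ⨅ z : g, Q₀.comap (LieModule.toEnd R g M z)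
  have mem_Q₁ {m : M} : m ∈ Q₁ ↔ m ∈ Q₀ ∧ ∀ z : g, ⁅z, m⁆ ∈ Q₀ := by
    simp only [Q₁, Submodule.mem_inf, Submodule.mem_iInf, Submodule.mem_comap,
      LieModule.toEnd_apply_apply]
  have hP₁ : P ≤ Q₁ := by
    refine fun p hp => mem_Q₁.mpr ⟨hP₀ hp, fun z => ?_⟩
    obtain ⟨x, hx, y, hy, rfl⟩ := Submodule.mem_sup.mp (hn ▸ Submodule.mem_top : z ∈ _)
    rw [add_lie]
    exact add_mem (hP₀ (mem_stabilizer.mp hx p hp)) (hn₀ hy (hP₀ hp))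
  have hn₁ : n ≤ stabilizer g Q₁ := by
    refine fun x hx => mem_stabilizer.mpr fun m hm =>
      mem_Q₁.mpr ⟨hn₀ hx (mem_Q₁.mp hm).1, fun z => ?_⟩
    rw [leibniz_lie]
    exact add_mem ((mem_Q₁.mp hm).2 _) (hn₀ hx ((mem_Q₁.mp hm).2 z))
  have hQ₁ : Q₀ ≤ Q₁ := sInf_le ⟨hP₁, hn₁⟩
  let N : LieSubmodule R g M := { Q₀ with lie_mem := fun {z} _ hm => (mem_Q₁.mp (hQ₁ hm)).2 z }
  have hN : LieSubmodule.lieSpan R g (P : Set M) ≤ N := LieSubmodule.lieSpan_le.mpr hP₀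
  exact le_trans hN (sInf_le ⟨hPQ, hQ⟩)

end Stabilizer

section Graded

variable {K g M M' : Type*} [Field K] [LieRing g] [LieAlgebra K g]
  [AddCommGroup M] [Module K M] [LieRingModule g M] [LieModule K g M]
  [AddCommGroup M'] [Module K M'] [LieRingModule g M'] [LieModule K g M']

variable (M) in
/-- The sum of the eigenspaces of `D` on `M` for the eigenvalues `a, a + 1, a + 2, …`. -/
def upperEigenspaces (D : g) (a : K) : Submodule K M :=
  ⨆ k : ℕ, (LieModule.toEnd K g M D).eigenspace (a + k)

variable {D : g} {a b : K}

lemma mem_upperEigenspaces (k : ℕ) {m : M} (hm : ⁅D, m⁆ = (a + k) • m) :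
    m ∈ upperEigenspaces M D a :=
  Submodule.mem_iSup_of_mem k (Module.End.mem_eigenspace_iff.mpr hm)

lemma lie_mem_upperEigenspaces {x : g} (hx : x ∈ upperEigenspaces g D b) {m : M}
    (hm : m ∈ upperEigenspaces M D a) : ⁅x, m⁆ ∈ upperEigenspaces M D (a + b) := by
  have h : Submodule.map₂ (LieModule.toEnd K g M : g →ₗ[K] Module.End K M)
      (upperEigenspaces g D b) (upperEigenspaces M D a) ≤ upperEigenspaces M D (a + b) := by
    simp only [upperEigenspaces, Submodule.map₂_iSup_left, Submodule.map₂_iSup_right]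
    refine iSup_le fun l => iSup_le fun k => Submodule.map₂_le.mpr fun y hy w hw => ?_
    have hy : ⁅D, y⁆ = (b + k) • y := Module.End.mem_eigenspace_iff.mp hy
    have hw : ⁅D, w⁆ = (a + l) • w := Module.End.mem_eigenspace_iff.mp hw
    refine mem_upperEigenspaces (k + l) ?_
    change ⁅D, ⁅y, w⁆⁆ = _ • ⁅y, w⁆
    rw [leibniz_lie, hy, hw, smul_lie, lie_smul, ← add_smul]
    congr 1
    push_cast
    ring
  exact h (Submodule.apply_mem_map₂ _ hx hm)

lemma upperEigenspaces_add_one_le : upperEigenspaces M D (a + 1) ≤ upperEigenspaces M D a :=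
  iSup_le fun k => le_iSup_of_le (k + 1) (le_of_eq (by push_cast; congr 1; ring))

lemma map_upperEigenspaces_le (f : M →ₗ⁅K,g⁆ M') :
    (upperEigenspaces M D a).map (f : M →ₗ[K] M') ≤ upperEigenspaces M' D a := by
  rw [upperEigenspaces, Submodule.map_iSup]
  exact iSup_mono fun k => map_eigenspace_le (fun v => f.map_lie D v) _

lemma disjoint_eigenspace_upperEigenspaces [CharZero K] :
    Disjoint ((LieModule.toEnd K g M D).eigenspace a) (upperEigenspaces M D (a + 1)) := by
  refine ((LieModule.toEnd K g M D).eigenspaces_iSupIndep a).mono_right (iSup_le fun k => ?_)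
  refine le_iSup₂_of_le (a + 1 + k) (fun h => ?_) le_rfl
  rw [add_assoc, add_eq_left, add_comm] at h
  exact Nat.cast_add_one_ne_zero k h

lemma lieSpan_le_sup_upperEigenspaces {P : Submodule K M}
    (hP : P ≤ (LieModule.toEnd K g M D).eigenspace a)
    (hstab : stabilizer g P ⊔ upperEigenspaces g D 1 = ⊤) :
    (LieSubmodule.lieSpan K g (P : Set M)).toSubmodule ≤ P ⊔ upperEigenspaces M D (a + 1) := by
  refine lieSpan_le_of_stabilizer_sup_eq_top hstab le_sup_left fun x hx m hm => ?_
  have hle : P ⊔ upperEigenspaces M D (a + 1) ≤ upperEigenspaces M D a :=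
    sup_le (hP.trans (le_iSup_of_le 0 (by simp))) upperEigenspaces_add_one_le
  exact Submodule.mem_sup_right (lie_mem_upperEigenspaces hx (hle hm))

lemma eq_eigenspace_of_lieSpan_eq_top [CharZero K] {P : Submodule K M}
    (hP : P ≤ (LieModule.toEnd K g M D).eigenspace a)
    (hstab : stabilizer g P ⊔ upperEigenspaces g D 1 = ⊤)
    (htop : LieSubmodule.lieSpan K g (P : Set M) = ⊤) :
    P = (LieModule.toEnd K g M D).eigenspace a := by
  have hsup : P ⊔ upperEigenspaces M D (a + 1) = ⊤ := by
    simpa only [htop, LieSubmodule.top_toSubmodule, top_le_iff] using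
      lieSpan_le_sup_upperEigenspaces hP hstab
  rw [← top_inf_eq ((LieModule.toEnd K g M D).eigenspace a), ← hsup, sup_inf_assoc_of_le _ hP,
    disjoint_eigenspace_upperEigenspaces.symm.eq_bot, sup_bot_eq]

end Graded

section Quotient

variable {R g M M' : Type*} [CommRing R] [LieRing g]
  [AddCommGroup M] [Module R M] [LieRingModule g M]
  [AddCommGroup M'] [Module R M'] [LieRingModule g M']

lemma surjective_of_isIrreducible [LieModule.IsIrreducible R g M'] {f : M →ₗ⁅R,g⁆ M'} {m : M}
    (hm : f m ≠ 0) : Function.Surjective f := by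
  rw [← LieModuleHom.range_eq_top]
  refine (eq_bot_or_eq_top f.range).resolve_left fun h => hm ?_
  exact (LieSubmodule.mem_bot _).mp (h ▸ (LieModuleHom.mem_range f _).mpr ⟨m, rfl⟩)

lemma map_mem_of_lieSpan_eq_top {m : M} (hm : LieSubmodule.lieSpan R g {m} = ⊤)
    {f : M →ₗ⁅R,g⁆ M'} {N : LieSubmodule R g M'} (hN : f m ∈ N) (m' : M) : f m' ∈ N := by
  have h : LieSubmodule.lieSpan R g {m} ≤ N.comap f :=
    LieSubmodule.lieSpan_le.mpr (Set.singleton_subset_iff.mpr hN)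
  exact h (hm ▸ LieSubmodule.mem_top m')

variable [LieAlgebra R g] [LieModule R g M]

lemma nonempty_quotient_ker_equiv {f : M →ₗ⁅R,g⁆ M'} (hf : Function.Surjective f) :
    Nonempty ((M ⧸ f.ker) ≃ₗ⁅R,g⁆ M') :=
  let e : (M ⧸ f.ker.toSubmodule) ≃ₗ[R] M' :=
    (Submodule.quotEquivOfEq _ _ (LieModuleHom.ker_toSubmodule f)).trans
      ((f : M →ₗ[R] M').quotKerEquivOfSurjective hf)
  ⟨{ e with
      map_lie' := by
        intro x q
        obtain ⟨m, rfl⟩ := LieSubmodule.Quotient.surjective_mk' f.ker q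
        exact f.map_lie x m }⟩

variable (R g M) in
/-- The sum of all proper submodules, i.e. the submodule divided out in `IrrQuotient`. -/
abbrev sumProper : LieSubmodule R g M := sSup {N : LieSubmodule R g M | N ≠ ⊤}

lemma isIrreducible_quotient_sumProper (h : sumProper R g M ≠ ⊤) :
    LieModule.IsIrreducible R g (M ⧸ sumProper R g M) := by
  have hmk := LieSubmodule.Quotient.surjective_mk' (sumProper R g M)
  have : Nontrivial (M ⧸ sumProper R g M) :=
    Submodule.Quotient.nontrivial_iff.mpr (by rwa [Ne, LieSubmodule.toSubmodule_eq_top])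
  refine LieModule.IsIrreducible.mk fun N hN => ?_
  by_contra hN'
  have hcomap : N.comap (LieSubmodule.Quotient.mk' (sumProper R g M)) ≠ ⊤ := by
    refine fun htop => hN' (eq_top_iff.mpr fun y _ => ?_)
    obtain ⟨m, rfl⟩ := hmk y
    exact LieSubmodule.mem_comap.mp (htop ▸ LieSubmodule.mem_top m)
  refine hN ((LieSubmodule.eq_bot_iff _).mpr fun y hy => ?_)
  obtain ⟨m, rfl⟩ := hmk y
  exact (LieSubmodule.Quotient.mk_eq_zero _).mpr (le_sSup (α := LieSubmodule R g M) hcomap hy)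

end Quotient

section LowestDegree

variable {K g M M' : Type*} [Field K] [LieRing g] [LieAlgebra K g]
  [AddCommGroup M] [Module K M] [LieRingModule g M] [LieModule K g M]
  [AddCommGroup M'] [Module K M'] [LieRingModule g M'] [LieModule K g M']

/-- `v` generates `M`, has degree `a` for the grading by the eigenvalues of `D`, and spans a line
stable under the part of the Lie algebra of degree `≤ 0`. Highest weight vectors are of this kind
when `D` is chosen such that positive root vectors have negative degree. -/
structure IsLowestDegreeGenerator (D : g) (a : K) (v : M) : Prop where
  lie_eq : ⁅D, v⁆ = a • v
  stabilizer_sup : stabilizer g (K ∙ v) ⊔ upperEigenspaces g D 1 = ⊤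
  lieSpan_eq_top : LieSubmodule.lieSpan K g {v} = ⊤

namespace IsLowestDegreeGenerator

variable {D : g} {a : K} {v : M}

lemma span_le_eigenspace (h : IsLowestDegreeGenerator D a v) :
    K ∙ v ≤ (LieModule.toEnd K g M D).eigenspace a :=
  (Submodule.span_singleton_le_iff_mem _ _).mpr (Module.End.mem_eigenspace_iff.mpr h.lie_eq)

lemma span_sup_upperEigenspaces (h : IsLowestDegreeGenerator D a v) :
    K ∙ v ⊔ upperEigenspaces M D (a + 1) = ⊤ := by
  have hle := lieSpan_le_sup_upperEigenspaces h.span_le_eigenspace h.stabilizer_sup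
  have htop : LieSubmodule.lieSpan K g (K ∙ v : Set M) = ⊤ :=
    eq_top_iff.mpr (h.lieSpan_eq_top ▸ LieSubmodule.lieSpan_mono Submodule.subset_span)
  rwa [htop, LieSubmodule.top_toSubmodule, top_le_iff] at hle

variable [CharZero K]

lemma notMem_map_upperEigenspaces (h : IsLowestDegreeGenerator D a v) {f : M →ₗ⁅K,g⁆ M'}
    (hf : f v ≠ 0) : f v ∉ (upperEigenspaces M D (a + 1)).map (f : M →ₗ[K] M') := fun hmem =>
  hf (Submodule.disjoint_def.mp disjoint_eigenspace_upperEigenspaces _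
    (map_eigenspace_le (fun m => f.map_lie D m) a
      (Submodule.mem_map_of_mem (h.span_le_eigenspace (Submodule.mem_span_singleton_self v))))
    (map_upperEigenspaces_le f hmem))

lemma le_upperEigenspaces (h : IsLowestDegreeGenerator D a v) {N : LieSubmodule K g M}
    (hN : N ≠ ⊤) : N.toSubmodule ≤ upperEigenspaces M D (a + 1) := by
  intro x hx
  obtain ⟨y, hy, z, hz, rfl⟩ :=
    Submodule.mem_sup.mp (h.span_sup_upperEigenspaces ▸ Submodule.mem_top : x ∈ _)
  obtain ⟨c, rfl⟩ := Submodule.mem_span_singleton.mp hy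
  rcases eq_or_ne c 0 with rfl | hc
  · rwa [zero_smul, zero_add]
  have hv : LieSubmodule.Quotient.mk' N v ≠ 0 := fun hv => hN <| by
    rw [eq_top_iff, ← h.lieSpan_eq_top, LieSubmodule.lieSpan_le, Set.singleton_subset_iff]
    exact (LieSubmodule.Quotient.mk_eq_zero N).mp hv
  refine absurd ⟨-(c⁻¹ • z), neg_mem (Submodule.smul_mem _ _ hz), (Submodule.Quotient.eq _).mpr ?_⟩
    (h.notMem_map_upperEigenspaces hv)
  have hsub : -(c⁻¹ • z) - v = -(c⁻¹ • (c • v + z)) := by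
    rw [smul_add, inv_smul_smul₀ hc, neg_add_rev, sub_eq_add_neg]
  exact hsub ▸ neg_mem (N.smul_mem _ hx)

lemma sumProper_le_upperEigenspaces (h : IsLowestDegreeGenerator D a v) :
    (sumProper K g M).toSubmodule ≤ upperEigenspaces M D (a + 1) := by
  rw [LieSubmodule.sSup_toSubmodule]
  refine sSup_le ?_
  rintro _ ⟨N, hN, rfl⟩
  exact h.le_upperEigenspaces hN

lemma isIrreducible (h : IsLowestDegreeGenerator D a v) (hv : v ≠ 0) :
    LieModule.IsIrreducible K g (M ⧸ sumProper K g M) := by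
  refine isIrreducible_quotient_sumProper fun htop => ?_
  refine h.notMem_map_upperEigenspaces (f := LieModuleHom.id) hv ⟨v, ?_, rfl⟩
  exact h.sumProper_le_upperEigenspaces (htop ▸ LieSubmodule.mem_top v)

variable [LieModule.IsIrreducible K g M']

lemma ker_eq_sumProper (h : IsLowestDegreeGenerator D a v) {f : M →ₗ⁅K,g⁆ M'} (hf : f v ≠ 0) :
    f.ker = sumProper K g M := by
  refine le_antisymm (le_sSup fun htop => hf ?_) ?_
  · exact LieModuleHom.mem_ker.mp (htop ▸ LieSubmodule.mem_top v)
  · rw [LieModuleHom.le_ker_iff_map]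
    by_contra hbot
    have hmem : f v ∈ (sumProper K g M).map f :=
      (eq_bot_or_eq_top _).resolve_left hbot ▸ LieSubmodule.mem_top _
    obtain ⟨m, hm, hmv⟩ := (LieSubmodule.mem_map _).mp hmem
    exact h.notMem_map_upperEigenspaces hf ⟨m, h.sumProper_le_upperEigenspaces hm, hmv⟩

lemma nonempty_equiv (h : IsLowestDegreeGenerator D a v) {f : M →ₗ⁅K,g⁆ M'} (hf : f v ≠ 0) :
    Nonempty ((M ⧸ sumProper K g M) ≃ₗ⁅K,g⁆ M') :=
  h.ker_eq_sumProper hf ▸ nonempty_quotient_ker_equiv (surjective_of_isIrreducible hf)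

end IsLowestDegreeGenerator

end LowestDegree

/-- For locally nilpotent `f` this replaces the finite-dimensionality assumption of
`IsSl2Triple.HasPrimitiveVectorWith.exists_nat`. -/
lemma exists_nat_eq_of_toEnd_pow_eq_zero {K g M : Type*} [Field K] [CharZero K] [LieRing g]
    [LieAlgebra K g] [AddCommGroup M] [Module K M] [LieRingModule g M] [LieModule K g M]
    {h e f : g} {t : IsSl2Triple h e f} {m : M} {μ : K} (hm : t.HasPrimitiveVectorWith m μ)
    (hf : ∃ k : ℕ, (LieModule.toEnd K g M f ^ k) m = 0) : ∃ k : ℕ, μ = k := by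
  obtain ⟨k, hk, hk'⟩ : ∃ k : ℕ, (LieModule.toEnd K g M f ^ k) m ≠ 0 ∧
      (LieModule.toEnd K g M f ^ (k + 1)) m = 0 := by
    by_contra! hne
    obtain ⟨k, hk⟩ := hf
    exact Nat.rec (motive := fun k => (LieModule.toEnd K g M f ^ k) m ≠ 0) hm.ne_zero hne k hk
  have hzero := hm.lie_e_pow_succ_toEnd_f k
  rw [hk', lie_zero, eq_comm, smul_eq_zero_iff_left hk, mul_eq_zero, sub_eq_zero] at hzero
  exact ⟨k, hzero.resolve_left (Nat.cast_add_one_ne_zero k)⟩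

section Closure

variable {W W' : Type*} [AddCommGroup W] [Module ℂ W] [LieRingModule glInf W] [LieModule ℂ glInf W]
  [AddCommGroup W'] [Module ℂ W'] [LieRingModule glInf W'] [LieModule ℂ glInf W']

lemma InCint.of_surjective (h : InCint W) {f : W →ₗ⁅ℂ,glInf⁆ W'} (hf : Function.Surjective f) :
    InCint W' where
  inC := hf.forall.mpr fun w => (h.inC w).imp fun T hT m n hn => by
    rw [← LieModuleHom.map_lie, hT m n hn, map_zero]
  integrable.semisimple n :=
    iSup_eigenspace_eq_top_of_surjective (h.integrable.semisimple n)
      (φ := (f : W →ₗ[ℂ] W')) (fun w => f.map_lie (E n n) w) hf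
  integrable.locallyNilpotent p q hpq := hf.forall.mpr fun w =>
    (h.integrable.locallyNilpotent p q hpq w).imp fun k hk => by
      rw [LieModule.toEnd_pow_apply_map, hk, map_zero]

lemma InCint.of_injective (h : InCint W') {f : W →ₗ⁅ℂ,glInf⁆ W'} (hf : Function.Injective f) :
    InCint W where
  inC w := (h.inC (f w)).imp fun T hT m n hn => hf <| by
    rw [LieModuleHom.map_lie, hT m n hn, map_zero]
  integrable.semisimple n :=
    iSup_eigenspace_eq_top_of_injective (h.integrable.semisimple n)
      (φ := (f : W →ₗ[ℂ] W')) (fun w => f.map_lie (E n n) w) hf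
  integrable.locallyNilpotent p q hpq w :=
    (h.integrable.locallyNilpotent p q hpq (f w)).imp fun k hk => hf <| by
      rw [← LieModule.toEnd_pow_apply_map, hk, map_zero]

lemma InCint.of_equiv (h : InCint W) (e : W' ≃ₗ⁅ℂ,glInf⁆ W) : InCint W' :=
  h.of_injective (f := e.toLieModuleHom) e.injective

end Closure

section Enveloping

variable {R g : Type*} [CommRing R] [LieRing g] [LieAlgebra R g]

lemma uea_smul_mem {X : Type*} [AddCommGroup X] [Module R X]
    [Module (UniversalEnvelopingAlgebra R g) X]
    [IsScalarTower R (UniversalEnvelopingAlgebra R g) X] {N : Submodule R X}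
    (hN : ∀ (x : g), ∀ m ∈ N, UniversalEnvelopingAlgebra.ι R x • m ∈ N)
    (a : UniversalEnvelopingAlgebra R g) {m : X} (hm : m ∈ N) : a • m ∈ N := by
  have hsurj : Function.Surjective (UniversalEnvelopingAlgebra.mkAlgHom R g) :=
    Quotient.mk_surjective
  obtain ⟨t, rfl⟩ := hsurj a
  induction t using TensorAlgebra.induction generalizing m with
  | algebraMap c =>
    rw [AlgHom.commutes, algebraMap_smul]
    exact N.smul_mem c hm
  | ι x => exact hN x m hm
  | mul a b ha hb =>
    rw [map_mul, mul_smul]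
    exact ha (hb hm)
  | add a b ha hb =>
    rw [map_add, add_smul]
    exact add_mem (ha hm) (hb hm)

variable (R g) (W : Type*) [AddCommGroup W] [Module R W] [LieRingModule g W] [LieModule R g W]

/-- The `U(g)`-module structure on a `g`-module, inverse to `lieRingModuleOfUEA`. -/
@[reducible]
def ueaModule : Module (UniversalEnvelopingAlgebra R g) W :=
  Module.compHom W (UniversalEnvelopingAlgebra.lift R (LieModule.toEnd R g W)).toRingHom

lemma isScalarTower_ueaModule :
    let _ := ueaModule R g W
    IsScalarTower R (UniversalEnvelopingAlgebra R g) W := by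
  let _ := ueaModule R g W
  refine ⟨fun c a w => ?_⟩
  exact LinearMap.congr_fun
    (map_smul (UniversalEnvelopingAlgebra.lift R (LieModule.toEnd R g W)) c a) w

lemma ι_smul_ueaModule (x : g) (w : W) :
    let _ := ueaModule R g W
    UniversalEnvelopingAlgebra.ι R x • w = ⁅x, w⁆ :=
  LinearMap.congr_fun (UniversalEnvelopingAlgebra.lift_ι_apply R (LieModule.toEnd R g W) x) w

end Enveloping

section MatrixUnits

lemma span_E : Submodule.span ℂ (Set.range fun p : ℤ × ℤ => E p.1 p.2) = ⊤ := by
  have h := Submodule.span_span_coe_preimage (R := ℂ) (s := {x | ∃ m n : ℤ, x = matUnit m n})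
  refine eq_top_iff.mpr (h.ge.trans (Submodule.span_mono ?_))
  rintro x ⟨m, n, hx⟩
  exact ⟨(m, n), Subtype.ext hx.symm⟩

lemma sup_eq_top_of_E_mem {P Q : Submodule ℂ glInf} (h : ∀ m n, E m n ∈ P ∨ E m n ∈ Q) :
    P ⊔ Q = ⊤ := by
  rw [eq_top_iff, ← span_E, Submodule.span_le, Set.range_subset_iff]
  exact fun p => (h p.1 p.2).elim (@le_sup_left _ _ P Q _) (@le_sup_right _ _ P Q _)

variable {S : Finset ℤ}

variable (S) in
lemma span_ES : Submodule.span ℂ (Set.range fun p : S × S => ES p.1.2 p.2.2) = ⊤ := by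
  have h := Submodule.span_span_coe_preimage (R := ℂ) (s := {x | ∃ m ∈ S, ∃ n ∈ S, x = E m n})
  refine eq_top_iff.mpr (h.ge.trans (Submodule.span_mono ?_))
  rintro x ⟨m, hm, n, hn, hx⟩
  exact ⟨(⟨m, hm⟩, ⟨n, hn⟩), Subtype.ext hx.symm⟩

lemma sup_eq_top_of_ES_mem {P Q : Submodule ℂ (glS S)}
    (h : ∀ m n (hm : m ∈ S) (hn : n ∈ S), ES hm hn ∈ P ∨ ES hm hn ∈ Q) : P ⊔ Q = ⊤ := by
  rw [eq_top_iff, ← span_ES, Submodule.span_le, Set.range_subset_iff]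
  exact fun p => (h _ _ p.1.2 p.2.2).elim (@le_sup_left _ _ P Q _) (@le_sup_right _ _ P Q _)

lemma lie_mem_glPlus {x y : glInf} (hx : x ∈ glPlus S) (hy : y ∈ glS S) : ⁅x, y⁆ ∈ glPlus S := by
  have h : Submodule.map₂ (LieModule.toEnd ℂ glInf glInf : glInf →ₗ[ℂ] Module.End ℂ glInf)
      (glPlus S) (glS S).toSubmodule ≤ glPlus S := by
    refine (Submodule.map₂_span_span ℂ _ _ _).trans_le (Submodule.span_le.mpr ?_)
    rintro _ ⟨_, ⟨m, n, hn, rfl⟩, _, ⟨p, hp, q, _, rfl⟩, rfl⟩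
    have hnp : n ≠ p := fun h => hn (h ▸ hp)
    change ⁅E m n, E p q⁆ ∈ glPlus S
    rw [lie_E, if_neg hnp, zero_sub, neg_mem_iff]
    split_ifs
    · exact Submodule.subset_span ⟨p, n, hn, rfl⟩
    · exact zero_mem _
  exact h (Submodule.apply_mem_map₂ _ hx hy)

/-- The diagonal matrix with entries `c i` for `i ∈ S`, used to define gradings of `gl_S` and
`gl_∞`. -/
def diag (S : Finset ℤ) (c : ℤ → ℤ) : glS S :=
  ∑ i : S, (c i : ℂ) • ES i.2 i.2

lemma coe_diag (c : ℤ → ℤ) : (diag S c : glInf) = ∑ i ∈ S, (c i : ℂ) • E i i := by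
  rw [diag, ← Finset.sum_coe_sort S fun i => (c i : ℂ) • E i i]
  exact map_sum (glS S).incl _ _

lemma lie_diag_E (c : ℤ → ℤ) (m n : ℤ) :
    ⁅(diag S c : glInf), E m n⁆ =
      (((if m ∈ S then c m else 0) - (if n ∈ S then c n else 0) : ℤ) : ℂ) • E m n := by
  have h (i : ℤ) : ⁅(c i : ℂ) • E i i, E m n⁆ =
      (if i = m then (c i : ℂ) • E m n else 0) - (if i = n then (c i : ℂ) • E m n else 0) := by
    rw [smul_lie, lie_E, smul_sub, smul_ite, smul_ite, smul_zero]
    congr 1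
    · exact if_ctx_congr Iff.rfl (fun h => by rw [h]) fun _ => rfl
    · exact if_ctx_congr Iff.rfl (fun h => by rw [h]) fun _ => rfl
  rw [coe_diag, sum_lie, Finset.sum_congr rfl fun i _ => h i, Finset.sum_sub_distrib,
    Finset.sum_ite_eq', Finset.sum_ite_eq']
  split_ifs <;> simp [sub_smul]

lemma lie_diag_ES (c : ℤ → ℤ) {m n : ℤ} (hm : m ∈ S) (hn : n ∈ S) :
    ⁅diag S c, ES hm hn⁆ = ((c m - c n : ℤ) : ℂ) • ES hm hn := by
  have h := lie_diag_E (S := S) c m n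
  rw [if_pos hm, if_pos hn] at h
  exact Subtype.ext h

lemma lie_diag_const (c : ℤ) (x : glS S) : ⁅diag S fun _ => c, x⁆ = 0 := by
  have h : LinearMap.ker (LieModule.toEnd ℂ (glS S) (glS S) (diag S fun _ => c)) = ⊤ := by
    rw [← sup_idem (LinearMap.ker _)]
    refine sup_eq_top_of_ES_mem fun m n hm hn => Or.inl (LinearMap.mem_ker.mpr ?_)
    rw [LieModule.toEnd_apply_apply, lie_diag_ES, sub_self, Int.cast_zero, zero_smul]
  exact LinearMap.mem_ker.mp (h ▸ Submodule.mem_top)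

end MatrixUnits

section HighestWeight

variable {S : Finset ℤ} {lam : Module.Dual ℂ H}
  {U U' : Type*} [AddCommGroup U] [Module ℂ U] [LieRingModule (glS S) U]
  [AddCommGroup U'] [Module ℂ U'] [LieRingModule (glS S) U']
  {W : Type*} [AddCommGroup W] [Module ℂ W] [LieRingModule glInf W] [LieModule ℂ glInf W]

/-- `u` is a (possibly zero) highest weight vector of weight `λ_S` of a `gl_S`-module. -/
structure IsHighestWeight (S : Finset ℤ) (lam : Module.Dual ℂ H) {U : Type*} [AddCommGroup U]
    [Module ℂ U] [LieRingModule (glS S) U] (u : U) : Prop where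
  upper : ∀ ⦃m n : ℤ⦄ (hm : m ∈ S) (hn : n ∈ S), m < n → ⁅ES hm hn, u⁆ = 0
  weight : ∀ ⦃i : ℤ⦄ (hi : i ∈ S), ⁅ES hi hi, u⁆ = lam (EH i) • u

lemma IsHighestWeight.map {u : U} (hu : IsHighestWeight S lam u) (f : U →ₗ⁅ℂ,glS S⁆ U') :
    IsHighestWeight S lam (f u) where
  upper m n hm hn h := by rw [← LieModuleHom.map_lie, hu.upper hm hn h, map_zero]
  weight i hi := by rw [← LieModuleHom.map_lie, hu.weight hi, map_smul]

/-- The eigenvalue of `diag S c` on vectors of weight `λ`. -/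
def diagWeight (S : Finset ℤ) (lam : Module.Dual ℂ H) (c : ℤ → ℤ) : ℂ :=
  ∑ i : S, (c i : ℂ) * lam (EH i)

variable [LieModule ℂ (glS S) U]

lemma IsHighestWeight.lie_diag {u : U} (hu : IsHighestWeight S lam u) (c : ℤ → ℤ) :
    ⁅diag S c, u⁆ = diagWeight S lam c • u := by
  rw [diag, sum_lie, diagWeight, Finset.sum_smul]
  exact Finset.sum_congr rfl fun i _ => by rw [smul_lie, hu.weight, smul_smul]

lemma IsHighestWeight.ES_mem_stabilizer {u : U} (hu : IsHighestWeight S lam u) {m n : ℤ}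
    (hm : m ∈ S) (hn : n ∈ S) (hmn : m ≤ n) : ES hm hn ∈ stabilizer (glS S) (ℂ ∙ u) := by
  refine mem_stabilizer.mpr fun w hw => ?_
  obtain ⟨c, rfl⟩ := Submodule.mem_span_singleton.mp hw
  rw [lie_smul]
  refine Submodule.smul_mem _ _ ?_
  rcases hmn.lt_or_eq with h | rfl
  · rw [hu.upper hm hn h]
    exact zero_mem _
  · rw [hu.weight hm]
    exact Submodule.smul_mem _ _ (Submodule.mem_span_singleton_self u)

lemma IsHighestWeight.isLowestDegreeGenerator {u : U} (hu : IsHighestWeight S lam u)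
    (hgen : LieSubmodule.lieSpan ℂ (glS S) {u} = ⊤) :
    IsLowestDegreeGenerator (diag S id) (diagWeight S lam id) u where
  lie_eq := hu.lie_diag id
  stabilizer_sup := by
    refine sup_eq_top_of_ES_mem fun m n hm hn => ?_
    rcases le_or_gt m n with h | h
    · exact Or.inl (hu.ES_mem_stabilizer hm hn h)
    · obtain ⟨k, hk⟩ := Int.le.dest h
      have hk' : m - n = 1 + k := by omega
      refine Or.inr (mem_upperEigenspaces k ?_)
      rw [lie_diag_ES, id, id, hk']
      push_cast
      rfl
  lieSpan_eq_top := hgen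

/-- The vectors annihilated by `gl_∞^{(S,+)}`. -/
def vacuum (S : Finset ℤ) (W : Type*) [AddCommGroup W] [Module ℂ W] [LieRingModule glInf W]
    [LieModule ℂ glInf W] : LieSubmodule ℂ (glS S) W where
  carrier := {w | ∀ x ∈ glPlus S, ⁅x, w⁆ = 0}
  add_mem' ha hb x hx := by rw [lie_add, ha x hx, hb x hx, add_zero]
  zero_mem' x _ := lie_zero x
  smul_mem' c w hw x hx := by rw [lie_smul, hw x hx, smul_zero]
  lie_mem {y w} hw x hx := by
    change ⁅x, ⁅(y : glInf), w⁆⁆ = 0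
    rw [leibniz_lie, hw x hx, hw _ (lie_mem_glPlus hx y.2), lie_zero, add_zero]

lemma mem_vacuum_iff {w : W} : w ∈ vacuum S W ↔ ∀ m n, n ∉ S → ⁅E m n, w⁆ = 0 := by
  refine ⟨fun hw m n hn => hw _ (Submodule.subset_span ⟨m, n, hn, rfl⟩), fun hw x hx => ?_⟩
  have h : glPlus S ≤
      LinearMap.ker ((LieModule.toEnd ℂ glInf W : glInf →ₗ[ℂ] Module.End ℂ W).flip w) := by
    refine Submodule.span_le.mpr ?_
    rintro _ ⟨m, n, hn, rfl⟩
    exact hw m n hn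
  exact h hx

lemma E_mem_stabilizer_of_le_vacuum {P : Submodule ℂ W} (hP : P ≤ (vacuum S W).toSubmodule)
    (m : ℤ) {n : ℤ} (hn : n ∉ S) : E m n ∈ stabilizer glInf P := by
  refine mem_stabilizer.mpr fun w hw => ?_
  rw [mem_vacuum_iff.mp (hP hw) m n hn]
  exact zero_mem P

lemma IsHighestWeight.exists_isLowestDegreeGenerator {v : W} (hv : IsHighestWeight S lam v)
    (hvac : v ∈ vacuum S W) (hgen : LieSubmodule.lieSpan ℂ glInf {v} = ⊤) :
    ∃ (D : glInf) (a : ℂ), IsLowestDegreeGenerator D a v := by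
  obtain ⟨N, hN⟩ := S.bddAbove
  -- The degree `i - (N + 1)` of `i ∈ S` is below the degree `0` of the indices outside `S`.
  refine ⟨diag S fun i => i - (N + 1), diagWeight S lam fun i => i - (N + 1), hv.lie_diag _,
    sup_eq_top_of_E_mem fun m n => ?_, hgen⟩
  by_cases hn : n ∈ S
  · by_cases hm : m ∈ S ∧ m ≤ n
    · exact Or.inl (hv.ES_mem_stabilizer hm.1 hn hm.2)
    · have hpos : 1 ≤ (if m ∈ S then m - (N + 1) else 0) - (if n ∈ S then n - (N + 1) else 0) := by
        have := hN hn
        split_ifs <;> grind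
      obtain ⟨k, hk⟩ := Int.le.dest hpos
      refine Or.inr (mem_upperEigenspaces k ?_)
      rw [lie_diag_E, ← hk]
      push_cast
      rfl
  · exact Or.inl (E_mem_stabilizer_of_le_vacuum
      ((Submodule.span_singleton_le_iff_mem _ _).mpr hvac) m hn)

/-- The vacuum vectors of degree `a` for the grading of `W` by the eigenvalues of minus the
identity matrix of `gl_S`. -/
def topLevel (S : Finset ℤ) (W : Type*) [AddCommGroup W] [Module ℂ W] [LieRingModule glInf W]
    [LieModule ℂ glInf W] (a : ℂ) : LieSubmodule ℂ (glS S) W where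
  toSubmodule := (vacuum S W).toSubmodule ⊓
    (LieModule.toEnd ℂ glInf W ((diag S fun _ => -1 : glS S) : glInf)).eigenspace a
  lie_mem {y w} hw := by
    refine ⟨(vacuum S W).lie_mem hw.1, Module.End.mem_eigenspace_iff.mpr ?_⟩
    have hw : ⁅diag S fun _ => -1, w⁆ = a • w := Module.End.mem_eigenspace_iff.mp hw.2
    change ⁅diag S fun _ => -1, ⁅y, w⁆⁆ = a • ⁅y, w⁆
    rw [leibniz_lie, lie_diag_const, zero_lie, hw, lie_smul, zero_add]

lemma stabilizer_sup_upperEigenspaces_eq_top {N : LieSubmodule ℂ (glS S) W}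
    (hN : N ≤ vacuum S W) :
    stabilizer glInf N.toSubmodule ⊔
      upperEigenspaces glInf ((diag S fun _ => -1 : glS S) : glInf) 1 = ⊤ := by
  refine sup_eq_top_of_E_mem fun m n => ?_
  by_cases hn : n ∈ S
  · by_cases hm : m ∈ S
    · exact Or.inl (mem_stabilizer.mpr fun w hw => N.lie_mem (x := ES hm hn) hw)
    · refine Or.inr (mem_upperEigenspaces 0 ?_)
      rw [lie_diag_E, if_neg hm, if_pos hn]
      norm_num
  · exact Or.inl (E_mem_stabilizer_of_le_vacuum hN m hn)

lemma isIrreducible_topLevel [LieModule.IsIrreducible ℂ glInf W] {a : ℂ} {v : W}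
    (hv : v ∈ topLevel S W a) (hv0 : v ≠ 0) :
    LieModule.IsIrreducible ℂ (glS S) (topLevel S W a) := by
  have : Nontrivial (topLevel S W a) := ⟨⟨v, hv⟩, 0, fun h => hv0 (congrArg Subtype.val h)⟩
  refine LieModule.IsIrreducible.mk fun N hN => ?_
  let P : LieSubmodule ℂ (glS S) W := N.map (topLevel S W a).incl
  have hPle : P ≤ topLevel S W a := LieSubmodule.map_incl_le
  have htop : LieSubmodule.lieSpan ℂ glInf (P : Set W) = ⊤ := by
    refine (eq_bot_or_eq_top _).resolve_left fun h => hN ((LieSubmodule.eq_bot_iff _).mpr ?_)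
    exact fun w hw => Subtype.ext <|
      (LieSubmodule.lieSpan_eq_bot_iff ℂ glInf W).mp h w (LieSubmodule.mem_map_of_mem hw)
  have hP : P.toSubmodule = _ := eq_eigenspace_of_lieSpan_eq_top (fun w hw => (hPle hw).2)
    (stabilizer_sup_upperEigenspaces_eq_top fun w hw => (hPle hw).1) htop
  refine eq_top_iff.mpr fun w _ => ?_
  obtain ⟨w', hw', h⟩ := (LieSubmodule.mem_map _).mp (hP.ge w.2.2 : (w : W) ∈ P)
  exact Subtype.ext h ▸ hw'

end HighestWeight

section VermaModules

variable {S : Finset ℤ} {lam : Module.Dual ℂ H}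

variable (S lam) in
/-- The projection `U(gl_S) → M(λ_S)`. -/
def vermaMk : UniversalEnvelopingAlgebra ℂ (glS S) →ₗ[UniversalEnvelopingAlgebra ℂ (glS S)]
    Verma S lam :=
  (vermaIdeal S lam).mkQ

lemma vermaMk_surjective : Function.Surjective (vermaMk S lam) :=
  (vermaIdeal S lam).mkQ_surjective

lemma vermaMk_eq_zero_iff {a : UniversalEnvelopingAlgebra ℂ (glS S)} :
    vermaMk S lam a = 0 ↔ a ∈ vermaIdeal S lam :=
  Submodule.Quotient.mk_eq_zero _

lemma lie_vermaMk_one (x : glS S) :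
    ⁅x, vermaMk S lam 1⁆ = vermaMk S lam (UniversalEnvelopingAlgebra.ι ℂ x) := by
  conv_rhs => rw [← mul_one (UniversalEnvelopingAlgebra.ι ℂ x), ← smul_eq_mul, map_smul]
  rfl

lemma lieSpan_vermaMk_one : LieSubmodule.lieSpan ℂ (glS S) {vermaMk S lam 1} = ⊤ := by
  refine eq_top_iff.mpr fun x _ => ?_
  obtain ⟨a, rfl⟩ := vermaMk_surjective x
  rw [← mul_one a, ← smul_eq_mul, map_smul]
  exact uea_smul_mem (fun _ _ => LieSubmodule.lie_mem _) a
    (LieSubmodule.subset_lieSpan (R := ℂ) (L := glS S) (Set.mem_singleton (vermaMk S lam 1)))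

lemma isHighestWeight_vermaMk_one : IsHighestWeight S lam (vermaMk S lam 1) where
  upper m n hm hn h := by
    rw [lie_vermaMk_one, vermaMk_eq_zero_iff]
    exact Submodule.subset_span (Or.inl ⟨m, n, hm, hn, h, rfl⟩)
  weight i hi := by
    rw [lie_vermaMk_one, ← sub_eq_zero, ← LinearMap.map_smul_of_tower, ← map_sub,
      vermaMk_eq_zero_iff, ← Algebra.algebraMap_eq_smul_one]
    exact Submodule.subset_span (Or.inr ⟨i, hi, rfl⟩)

variable {U : Type*} [AddCommGroup U] [Module ℂ U] [LieRingModule (glS S) U]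

lemma IsHighestWeight.exists_verma_hom [LieModule ℂ (glS S) U] {u : U}
    (hu : IsHighestWeight S lam u) :
    ∃ f : Verma S lam →ₗ⁅ℂ,glS S⁆ U, f (vermaMk S lam 1) = u := by
  let _ := ueaModule ℂ (glS S) U
  have := isScalarTower_ueaModule ℂ (glS S) U
  let ψ := LinearMap.toSpanSingleton (UniversalEnvelopingAlgebra ℂ (glS S)) U u
  have hψ : vermaIdeal S lam ≤ LinearMap.ker ψ := by
    refine Submodule.span_le.mpr ?_
    rintro _ (⟨m, n, hm, hn, h, rfl⟩ | ⟨i, hi, rfl⟩) <;>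
      rw [SetLike.mem_coe, LinearMap.mem_ker, LinearMap.toSpanSingleton_apply]
    · rw [ι_smul_ueaModule, hu.upper hm hn h]
    · rw [sub_smul, ι_smul_ueaModule, hu.weight hi, algebraMap_smul, sub_self]
  let f := (vermaIdeal S lam).liftQ ψ hψ
  exact ⟨{ f.restrictScalars ℂ with
    map_lie' := fun {x m} => (f.map_smul _ m).trans (ι_smul_ueaModule _ _ U x (f m)) },
    one_smul (UniversalEnvelopingAlgebra ℂ (glS S)) u⟩

lemma IsHighestWeight.nonempty_LS_equiv [LieModule ℂ (glS S) U]
    [LieModule.IsIrreducible ℂ (glS S) U] {u : U} (hu : IsHighestWeight S lam u) (hu0 : u ≠ 0) :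
    Nonempty (LS S lam ≃ₗ⁅ℂ,glS S⁆ U) := by
  obtain ⟨f, rfl⟩ := hu.exists_verma_hom
  exact (isHighestWeight_vermaMk_one.isLowestDegreeGenerator lieSpan_vermaMk_one).nonempty_equiv hu0

variable (S lam) in
/-- The canonical highest weight vector of `L(λ_S)`. -/
def lsGen : LS S lam :=
  LieSubmodule.Quotient.mk' _ (vermaMk S lam 1)

lemma isHighestWeight_lsGen : IsHighestWeight S lam (lsGen S lam) :=
  isHighestWeight_vermaMk_one.map (LieSubmodule.Quotient.mk' _)

lemma lieSpan_lsGen : LieSubmodule.lieSpan ℂ (glS S) {lsGen S lam} = ⊤ := by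
  refine eq_top_iff.mpr fun x _ => ?_
  obtain ⟨m, rfl⟩ := LieSubmodule.Quotient.surjective_mk' _ x
  exact map_mem_of_lieSpan_eq_top lieSpan_vermaMk_one
    (LieSubmodule.subset_lieSpan (Set.mem_singleton _)) m

variable (S U) in
/-- The projection `U(gl_∞) ⊗ U → M(S, U)`. -/
def genVermaMk : UniversalEnvelopingAlgebra ℂ glInf ⊗[ℂ] U →ₗ[UniversalEnvelopingAlgebra ℂ glInf]
    GenVerma S U :=
  (genVermaRel S U).mkQ

lemma genVermaMk_surjective : Function.Surjective (genVermaMk S U) :=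
  (genVermaRel S U).mkQ_surjective

lemma genVermaMk_eq_zero_iff {t : UniversalEnvelopingAlgebra ℂ glInf ⊗[ℂ] U} :
    genVermaMk S U t = 0 ↔ t ∈ genVermaRel S U :=
  Submodule.Quotient.mk_eq_zero _

lemma genVermaMk_tmul (a : UniversalEnvelopingAlgebra ℂ glInf) (u : U) :
    genVermaMk S U (a ⊗ₜ u) = a • genVermaMk S U (1 ⊗ₜ u) := by
  rw [← map_smul, TensorProduct.smul_tmul', smul_eq_mul, mul_one]

lemma lie_genVermaMk_one_tmul (x : glInf) (u : U) :
    ⁅x, genVermaMk S U (1 ⊗ₜ u)⁆ = genVermaMk S U (UniversalEnvelopingAlgebra.ι ℂ x ⊗ₜ u) :=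
  (genVermaMk_tmul _ u).symm

variable (S U) in
/-- The canonical map `u ↦ 1 ⊗ u` from `U` to `M(S, U)`. -/
def genVermaIncl : U →ₗ⁅ℂ,glS S⁆ GenVerma S U where
  toLinearMap := (genVermaMk S U).restrictScalars ℂ ∘ₗ TensorProduct.mk ℂ _ U 1
  map_lie' {x u} := by
    refine Eq.trans (Eq.symm ?_) (lie_genVermaMk_one_tmul (x : glInf) u).symm
    rw [← sub_eq_zero, LinearMap.toFun_eq_coe]
    change genVermaMk S U _ - genVermaMk S U _ = 0
    rw [← map_sub, genVermaMk_eq_zero_iff]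
    exact Submodule.subset_span (Or.inl ⟨x, u, rfl⟩)

lemma genVermaIncl_mem_vacuum (u : U) : genVermaIncl S U u ∈ vacuum S (GenVerma S U) :=
  fun x hx => (lie_genVermaMk_one_tmul x u).trans <|
    genVermaMk_eq_zero_iff.mpr (Submodule.subset_span (Or.inr ⟨x, hx, u, rfl⟩))

lemma lieSpan_genVermaIncl {u : U} (hu : LieSubmodule.lieSpan ℂ (glS S) {u} = ⊤) :
    LieSubmodule.lieSpan ℂ glInf {genVermaIncl S U u} = ⊤ := by
  let N := LieSubmodule.lieSpan ℂ glInf {genVermaIncl S U u}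
  have hN (u' : U) : genVermaIncl S U u' ∈ N :=
    map_mem_of_lieSpan_eq_top (N := N.restr (glS S)) hu
      (LieSubmodule.subset_lieSpan (Set.mem_singleton _)) u'
  refine eq_top_iff.mpr fun y _ => ?_
  obtain ⟨t, rfl⟩ := genVermaMk_surjective y
  induction t using TensorProduct.induction_on with
  | zero => exact map_zero (genVermaMk S U) ▸ N.zero_mem
  | add s t hs ht => exact map_add (genVermaMk S U) s t ▸ N.add_mem (hs trivial) (ht trivial)
  | tmul a u' =>
    exact genVermaMk_tmul (S := S) a u' ▸ uea_smul_mem (fun _ _ => N.lie_mem) a (hN u')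

variable {W : Type*} [AddCommGroup W] [Module ℂ W] [LieRingModule glInf W] [LieModule ℂ glInf W]

lemma exists_genVerma_hom {φ : U →ₗ⁅ℂ,glS S⁆ W} (hφ : ∀ u, φ u ∈ vacuum S W) :
    ∃ F : GenVerma S U →ₗ⁅ℂ,glInf⁆ W, ∀ u, F (genVermaIncl S U u) = φ u := by
  let _ := ueaModule ℂ glInf W
  have := isScalarTower_ueaModule ℂ glInf W
  have := IsScalarTower.to_smulCommClass (R := ℂ) (A := UniversalEnvelopingAlgebra ℂ glInf) (M := W)
  let ψ := TensorProduct.AlgebraTensorModule.lift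
    (LinearMap.toSpanSingleton (UniversalEnvelopingAlgebra ℂ glInf) (U →ₗ[ℂ] W) φ)
  have hψ (a u) : ψ (a ⊗ₜ u) = a • φ u := rfl
  have hker : genVermaRel S U ≤ LinearMap.ker ψ := by
    refine Submodule.span_le.mpr ?_
    rintro _ (⟨x, u, rfl⟩ | ⟨x, hx, u, rfl⟩) <;> rw [SetLike.mem_coe, LinearMap.mem_ker]
    · rw [map_sub, hψ, hψ, ι_smul_ueaModule, one_smul, LieModuleHom.map_lie]
      exact sub_self _
    · rw [hψ, ι_smul_ueaModule, hφ u x hx]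
  let F := (genVermaRel S U).liftQ ψ hker
  exact ⟨{ F.restrictScalars ℂ with
    map_lie' := fun {x m} => (F.map_smul _ m).trans (ι_smul_ueaModule _ _ W x (F m)) },
    fun u => one_smul (UniversalEnvelopingAlgebra ℂ glInf) (φ u)⟩

lemma exists_isLowestDegreeGenerator_genVerma : ∃ (D : glInf) (a : ℂ),
    IsLowestDegreeGenerator D a (genVermaIncl S _ (lsGen S lam)) :=
  (isHighestWeight_lsGen.map _).exists_isLowestDegreeGenerator (genVermaIncl_mem_vacuum _)
    (lieSpan_genVermaIncl lieSpan_lsGen)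

variable [LieModule.IsIrreducible ℂ glInf W] {v : W}

lemma IsHighestWeight.exists_hom_of_mem_vacuum (hv : IsHighestWeight S lam v)
    (hvac : v ∈ vacuum S W) (hv0 : v ≠ 0) :
    ∃ F : GenVerma S (LS S lam) →ₗ⁅ℂ,glInf⁆ W, F (genVermaIncl S _ (lsGen S lam)) ≠ 0 := by
  let T := topLevel S W (diagWeight S lam fun _ => -1)
  let v' : T := ⟨v, hvac, Module.End.mem_eigenspace_iff.mpr (hv.lie_diag _)⟩
  have hv' : IsHighestWeight S lam v' :=
    ⟨fun _ _ hm hn h => Subtype.ext (hv.upper hm hn h), fun _ hi => Subtype.ext (hv.weight hi)⟩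
  have := isIrreducible_topLevel v'.2 hv0
  obtain ⟨e⟩ := hv'.nonempty_LS_equiv fun h => hv0 (congrArg Subtype.val h)
  let φ : LS S lam →ₗ⁅ℂ,glS S⁆ W := T.incl.comp (e : LS S lam →ₗ⁅ℂ,glS S⁆ T)
  have hφ : φ (e.symm v') = v := congrArg Subtype.val (e.apply_symm_apply v')
  obtain ⟨F, hF⟩ := exists_genVerma_hom (φ := φ) fun u => (e u).2.1
  refine ⟨F, fun h0 => hv0 (hφ ▸ (LieSubmodule.mem_bot (R := ℂ) (L := glS S) _).mp ?_)⟩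
  refine map_mem_of_lieSpan_eq_top lieSpan_lsGen ((LieSubmodule.mem_bot _).mpr ?_) _
  rw [← hF, h0]

lemma IsHighestWeight.isIrreducible_L (hv : IsHighestWeight S lam v)
    (hvac : v ∈ vacuum S W) (hv0 : v ≠ 0) : LieModule.IsIrreducible ℂ glInf (L S lam) := by
  obtain ⟨F, hF⟩ := hv.exists_hom_of_mem_vacuum hvac hv0
  obtain ⟨D, a, h⟩ := exists_isLowestDegreeGenerator_genVerma (S := S) (lam := lam)
  exact h.isIrreducible fun h0 => hF (by rw [h0, map_zero])

lemma IsHighestWeight.nonempty_L_equiv (hv : IsHighestWeight S lam v)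
    (hvac : v ∈ vacuum S W) (hv0 : v ≠ 0) : Nonempty (L S lam ≃ₗ⁅ℂ,glInf⁆ W) := by
  obtain ⟨F, hF⟩ := hv.exists_hom_of_mem_vacuum hvac hv0
  obtain ⟨D, a, h⟩ := exists_isLowestDegreeGenerator_genVerma (S := S) (lam := lam)
  exact h.nonempty_equiv hF

end VermaModules

section LinearForms

attribute [local instance 100] LieRing.ofAssociativeRing

/-- The linear form on `H` with value `a i` on `E_{i,i}` for `i ∈ S` and zero on the others. -/
def diagForm (S : Finset ℤ) (a : ℤ → ℂ) : Module.Dual ℂ H :=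
  ∑ i ∈ S, a i • ((Finsupp.lapply i : CInf →ₗ[ℂ] ℂ) ∘ₗ
    LinearMap.applyₗ (Finsupp.single i 1) ∘ₗ glInf.toSubmodule.subtype ∘ₗ H.subtype)

lemma diagForm_EH (S : Finset ℤ) (a : ℤ → ℂ) (j : ℤ) :
    diagForm S a (EH j) = if j ∈ S then a j else 0 := by
  have h (i : ℤ) : matUnit j j (Finsupp.single i 1) i = if i = j then 1 else 0 := by
    by_cases h : i = j <;> simp [matUnit, h]
  rw [diagForm, LinearMap.sum_apply, ← Finset.sum_ite_eq' S j a]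
  refine Finset.sum_congr rfl fun i _ => (congrArg (a i * ·) (h i)).trans ?_
  rw [mul_ite, mul_one, mul_zero]

end LinearForms

section Integrable

lemma E_ne_zero (m n : ℤ) : E m n ≠ 0 := by
  intro h
  have hm : matUnit m n (Finsupp.single n 1) m = 0 := by
    rw [show matUnit m n = 0 from congrArg Subtype.val h]
    rfl
  simp [matUnit] at hm

lemma isSl2Triple_E {m p : ℤ} (h : m ≠ p) :
    IsSl2Triple (E m m - E p p) (E m p) (E p m) where
  h_ne_zero h0 := by
    have h2 : (2 : ℂ) • E m p = 0 := by
      have hlie : ⁅E m m - E p p, E m p⁆ = 0 := by rw [h0, zero_lie]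
      simpa [sub_lie, lie_E, h, h.symm, two_smul] using hlie
    exact E_ne_zero m p ((smul_eq_zero.mp h2).resolve_left two_ne_zero)
  lie_e_f := by simp [lie_E]
  lie_h_e_nsmul := by simp [sub_lie, lie_E, two_nsmul, h, h.symm]
  lie_h_f_nsmul := by
    simp only [sub_lie, lie_E, two_nsmul, h, h.symm, if_true, if_false]
    abel

variable {S : Finset ℤ} {μ : ℤ → ℂ} {W : Type*} [AddCommGroup W] [Module ℂ W]
  [LieRingModule glInf W] [LieModule ℂ glInf W]

lemma IsIntegrable.exists_nat_eq_sub (h : IsIntegrable W) {m p : ℤ} (hmp : m ≠ p) {w : W}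
    (hw0 : w ≠ 0) {μ ν : ℂ} (hm : ⁅E m m, w⁆ = μ • w) (hp : ⁅E p p, w⁆ = ν • w)
    (he : ⁅E m p, w⁆ = 0) : ∃ k : ℕ, μ - ν = k :=
  exists_nat_eq_of_toEnd_pow_eq_zero (t := isSl2Triple_E hmp)
    { ne_zero := hw0, lie_h := by rw [sub_lie, hm, hp, sub_smul], lie_e := he }
    (h.locallyNilpotent p m hmp.symm w)

/-- The vectors annihilated by `gl_∞^{(S,+)}` on which `E_{i,i}`, `i ∈ S`, acts by `μ i`. -/
def vacuumWeightSpace (S : Finset ℤ) (W : Type*) [AddCommGroup W] [Module ℂ W]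
    [LieRingModule glInf W] [LieModule ℂ glInf W] (μ : ℤ → ℂ) : Submodule ℂ W :=
  (vacuum S W).toSubmodule ⊓ ⨅ i ∈ S, (LieModule.toEnd ℂ glInf W (E i i)).eigenspace (μ i)

lemma mem_vacuumWeightSpace_iff {w : W} :
    w ∈ vacuumWeightSpace S W μ ↔ w ∈ vacuum S W ∧ ∀ i ∈ S, ⁅E i i, w⁆ = μ i • w := by
  simp only [vacuumWeightSpace, Submodule.mem_inf, Submodule.mem_iInf,
    Module.End.mem_eigenspace_iff, LieModule.toEnd_apply_apply, LieSubmodule.mem_toSubmodule]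

lemma lie_E_mem_vacuumWeightSpace {m n : ℤ} (hm : m ∈ S) (hn : n ∈ S) {w : W}
    (hw : w ∈ vacuumWeightSpace S W μ) :
    ⁅E m n, w⁆ ∈ vacuumWeightSpace S W (μ + Pi.single m 1 - Pi.single n 1) := by
  obtain ⟨hvac, hμ⟩ := mem_vacuumWeightSpace_iff.mp hw
  refine mem_vacuumWeightSpace_iff.mpr
    ⟨(vacuum S W).lie_mem (x := ES hm hn) hvac, fun i hi => ?_⟩
  have hE : ⁅E i i, E m n⁆ =
      ((Pi.single m 1 : ℤ → ℂ) i - (Pi.single n 1 : ℤ → ℂ) i) • E m n := by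
    rw [lie_E, sub_smul, Pi.single_apply, Pi.single_apply]
    congr 1 <;> split_ifs with h <;> simp [h]
  rw [leibniz_lie, hE, hμ i hi, lie_smul, smul_lie, ← add_smul, Pi.sub_apply, Pi.add_apply]
  congr 1
  ring

lemma IsIntegrable.exists_mem_vacuumWeightSpace (h : IsIntegrable W) (hvac : vacuum S W ≠ ⊥) :
    ∃ μ, ∃ w ∈ vacuumWeightSpace S W μ, w ≠ 0 := by
  have hcomm (i j : ℤ) : Commute (LieModule.toEnd ℂ glInf W (E i i))
      (LieModule.toEnd ℂ glInf W (E j j)) := by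
    have hij : ⁅E i i, E j j⁆ = 0 := by
      rcases eq_or_ne i j with rfl | h
      · exact lie_self _
      · simp [lie_E, h]
    refine LinearMap.ext fun w => ?_
    change ⁅E i i, ⁅E j j, w⁆⁆ = ⁅E j j, ⁅E i i, w⁆⁆
    rw [leibniz_lie, hij, zero_lie, zero_add]
  have hinv (i : ℤ) : (vacuum S W).toSubmodule ∈
      (LieModule.toEnd ℂ glInf W (E i i)).invtSubmodule := by
    intro w hw
    by_cases hi : i ∈ S
    · exact (vacuum S W).lie_mem (x := ES hi hi) hw
    · exact mem_stabilizer.mp (E_mem_stabilizer_of_le_vacuum le_rfl i hi) w hw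
  obtain ⟨μ, w, hw, hw0, hμ⟩ := exists_mem_forall_apply_eq_smul h.semisimple hcomm hinv
    (mt (LieSubmodule.toSubmodule_eq_bot _).mp hvac) S
  exact ⟨μ, w, mem_vacuumWeightSpace_iff.mpr ⟨hw, hμ⟩, hw0⟩

lemma IsIntegrable.exists_nat_eq (h : IsIntegrable W) {w : W}
    (hw : w ∈ vacuumWeightSpace S W μ) (hw0 : w ≠ 0) : ∃ a : ℤ → ℕ, ∀ i ∈ S, μ i = a i := by
  obtain ⟨hvac, hμ⟩ := mem_vacuumWeightSpace_iff.mp hw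
  obtain ⟨p, hp⟩ := Infinite.exists_notMem_finset S
  have hE := mem_vacuum_iff.mp hvac
  have hi (i : ℤ) (hi : i ∈ S) : ∃ k : ℕ, μ i = k := by
    have hpp : ⁅E p p, w⁆ = (0 : ℂ) • w := by rw [hE p p hp, zero_smul]
    simpa only [sub_zero] using
      h.exists_nat_eq_sub (ne_of_mem_of_not_mem hi hp) hw0 (hμ i hi) hpp (hE i p hp)
  choose! a ha using hi
  exact ⟨a, ha⟩

/-- For `a ∈ ℕ^S` the integer `∑ i, (i - r) a i` is nonnegative when `r` is a lower bound of `S`,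
and `E_{m,n}` lowers it when `m < n`; so a vacuum weight vector minimizing it is killed by
these. -/
lemma IsIntegrable.exists_upper_eq_zero (h : IsIntegrable W) (hvac : vacuum S W ≠ ⊥) :
    ∃ a : ℤ → ℕ, ∃ v ∈ vacuumWeightSpace S W (fun i => a i), v ≠ 0 ∧
      ∀ m ∈ S, ∀ n ∈ S, m < n → ⁅E m n, v⁆ = 0 := by
  obtain ⟨r, hr⟩ := S.bddBelow
  let size (a : ℤ → ℕ) : ℤ := ∑ i ∈ S, (i - r) * a i
  have size_nonneg (a : ℤ → ℕ) : 0 ≤ size a :=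
    Finset.sum_nonneg fun i hi => mul_nonneg (sub_nonneg.mpr (hr hi)) (Int.natCast_nonneg _)
  let J : Set (ℤ → ℕ) := {a | ∃ w ∈ vacuumWeightSpace S W (fun i => a i), w ≠ 0}
  have mem_J {μ : ℤ → ℂ} {w : W} (hw : w ∈ vacuumWeightSpace S W μ) (hw0 : w ≠ 0) :
      ∃ a ∈ J, ∀ i ∈ S, μ i = a i := by
    obtain ⟨a, ha⟩ := h.exists_nat_eq hw hw0
    refine ⟨a, ⟨w, ?_, hw0⟩, ha⟩
    rw [mem_vacuumWeightSpace_iff] at hw ⊢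
    exact ⟨hw.1, fun i hi => by rw [hw.2 i hi, ha i hi]⟩
  obtain ⟨μ, w, hw, hw0⟩ := h.exists_mem_vacuumWeightSpace hvac
  obtain ⟨a₀, ha₀, -⟩ := mem_J hw hw0
  obtain ⟨a, ⟨v, hv, hv0⟩, hmin⟩ := (measure fun a => (size a).toNat).wf.has_min J ⟨a₀, ha₀⟩
  refine ⟨a, v, hv, hv0, fun m hm n hn hmn => ?_⟩
  by_contra hne
  obtain ⟨b, hbJ, hb⟩ := mem_J (lie_E_mem_vacuumWeightSpace hm hn hv) hne
  have hb' (i : ℤ) (hi : i ∈ S) :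
      (b i : ℤ) = a i + (Pi.single m 1 : ℤ → ℤ) i - (Pi.single n 1 : ℤ → ℤ) i := by
    have := hb i hi
    simp only [Pi.sub_apply, Pi.add_apply, Pi.single_apply] at this ⊢
    exact_mod_cast this.symm
  have hsize : size b = size a + (m - n) := by
    simp only [size]
    rw [Finset.sum_congr rfl fun i hi => by rw [hb' i hi]]
    simp only [Pi.single_apply, mul_sub, mul_add, Finset.sum_sub_distrib, Finset.sum_add_distrib,
      mul_ite, mul_one, mul_zero, Finset.sum_ite_eq', hm, hn, if_true]
    ring
  have hlt := hmin b hbJ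
  have := size_nonneg b
  change ¬ (size b).toNat < (size a).toNat at hlt
  omega

lemma IsIntegrable.exists_isHighestWeight (h : IsIntegrable W) (hvac : vacuum S W ≠ ⊥) :
    ∃ lam ∈ PPlus S, ∃ v ∈ vacuum S W, v ≠ 0 ∧ IsHighestWeight S lam v := by
  obtain ⟨a, v, hv, hv0, hupper⟩ := h.exists_upper_eq_zero hvac
  obtain ⟨hv, hvS⟩ := mem_vacuumWeightSpace_iff.mp hv
  refine ⟨diagForm S fun i => a i, ⟨fun i => if i ∈ S then a i else 0, fun i => ?_,
    fun i hi => if_neg hi, fun i hi j hj hij => ?_⟩, v, hv, hv0,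
    fun m n hm hn => hupper m hm n hn, fun i hi => ?_⟩
  · rw [diagForm_EH]
    by_cases hi : i ∈ S <;> simp [hi]
  · obtain ⟨k, hk⟩ := h.exists_nat_eq_sub hij.ne hv0 (hvS i hi) (hvS j hj) (hupper i hi j hj hij)
    have hk : a i = k + a j := by exact_mod_cast sub_eq_iff_eq_add.mp hk
    simp only [hi, hj, if_true, hk, le_add_iff_nonneg_left, zero_le]
  · rw [diagForm_EH, if_pos hi]
    exact hvS i hi

lemma InCint.exists_isHighestWeight [Nontrivial W] (h : InCint W) :
    ∃ r n : ℤ, r < n ∧ ∃ lam ∈ PPlus (Finset.Icc r n), ∃ v ∈ vacuum (Finset.Icc r n) W, v ≠ 0 ∧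
      IsHighestWeight (Finset.Icc r n) lam v := by
  obtain ⟨w, hw⟩ := exists_ne (0 : W)
  obtain ⟨T, hT⟩ := h.inC w
  obtain ⟨r, hr⟩ := T.bddBelow
  obtain ⟨n, hn⟩ := T.bddAbove
  have hsub : T ⊆ Finset.Icc r (max n (r + 1)) := fun i hi =>
    Finset.mem_Icc.mpr ⟨hr hi, le_max_of_le_left (hn hi)⟩
  have hvac : w ∈ vacuum (Finset.Icc r (max n (r + 1))) W :=
    mem_vacuum_iff.mpr fun m k hk => hT m k (mt (@hsub k) hk)
  exact ⟨r, _, lt_max_of_lt_right (lt_add_one r), h.integrable.exists_isHighestWeight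
    fun hbot => hw ((LieSubmodule.mem_bot w).mp (hbot ▸ hvac))⟩

end Integrable

section Derivations

variable {R A M : Type*} [CommRing R] [CommRing A] [Algebra R A]
  [AddCommGroup M] [Module R M] [Module A M]

lemma derivation_prod {ι : Type*} [DecidableEq ι] (D : Derivation R A M) (s : Finset ι)
    (f : ι → A) : D (∏ i ∈ s, f i) = ∑ i ∈ s, (∏ k ∈ s.erase i, f k) • D (f i) := by
  induction s using Finset.induction_on with
  | empty => simp
  | insert j s hj ih =>
    rw [Finset.prod_insert hj, Derivation.leibniz, ih, Finset.sum_insert hj,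
      Finset.erase_insert hj, add_comm, Finset.smul_sum]
    congr 1
    refine Finset.sum_congr rfl fun i hi => ?_
    have hji : j ≠ i := ne_of_mem_of_not_mem hi hj |>.symm
    rw [Finset.erase_insert_of_ne hji, Finset.prod_insert (mt Finset.mem_of_mem_erase hj), mul_smul]

variable (D : Derivation R A A)

lemma derivation_det {κ : Type*} [Fintype κ] [DecidableEq κ] (B : Matrix κ κ A) :
    D B.det = ∑ p, (B.updateRow p fun q => D (B p q)).det := by
  simp only [← Matrix.det_transpose B, ← Matrix.det_transpose (B.updateRow _ _), Matrix.det_apply,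
    map_sum]
  rw [Finset.sum_comm]
  refine Finset.sum_congr rfl fun σ _ => ?_
  rw [Units.smul_def, map_zsmul, derivation_prod, Finset.smul_sum]
  refine Finset.sum_congr rfl fun p _ => ?_
  rw [← Finset.prod_erase_mul _ _ (Finset.mem_univ p), Units.smul_def, smul_eq_mul]
  congr 2
  · refine Finset.prod_congr rfl fun k hk => ?_
    rw [Matrix.transpose_apply, Matrix.transpose_apply,
      Matrix.updateRow_ne (Finset.ne_of_mem_erase hk)]
  · rw [Matrix.transpose_apply, Matrix.transpose_apply, Matrix.updateRow_self]

variable {D}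

lemma derivation_pow_eq_smul {f : A} {c : R} (hf : D f = c • f) (k : ℕ) :
    D (f ^ k) = (k * c) • f ^ k := by
  cases k with
  | zero => simp
  | succ k =>
    rw [Derivation.leibniz_pow, hf, Nat.add_sub_cancel, smul_comm _ c, smul_eq_mul, ← pow_succ,
      ← Nat.cast_smul_eq_nsmul R, smul_smul, mul_comm]

lemma derivation_prod_eq_smul {ι : Type*} {s : Finset ι} {f : ι → A} {c : ι → R}
    (hf : ∀ i ∈ s, D (f i) = c i • f i) :
    D (∏ i ∈ s, f i) = (∑ i ∈ s, c i) • ∏ i ∈ s, f i := by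
  classical
  rw [derivation_prod, Finset.sum_smul]
  refine Finset.sum_congr rfl fun i hi => ?_
  rw [hf i hi, smul_comm, smul_eq_mul, Finset.prod_erase_mul _ _ hi]

lemma derivation_pow_succ_mul_eq_zero {f y : A} (hy : D (D y) = 0) {k : ℕ}
    (hf : ((D : A →ₗ[R] A) ^ k) f = 0) : ((D : A →ₗ[R] A) ^ (k + 1)) (f * y) = 0 := by
  have hcomm : Commute (D : A →ₗ[R] A) (LinearMap.mulRight R (D y)) := by
    refine LinearMap.ext fun g => ?_
    change D (g * D y) = D g * D y
    rw [Derivation.leibniz, hy, smul_zero, zero_add, smul_eq_mul, mul_comm]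
  induction k generalizing f with
  | zero => simp_all
  | succ k ih =>
    have hleib : D (f * y) = D f * y + LinearMap.mulRight R (D y) f := by
      rw [Derivation.leibniz, smul_eq_mul, smul_eq_mul, mul_comm y, add_comm]
      rfl
    have hdf : ((D : A →ₗ[R] A) ^ (k + 1)) (LinearMap.mulRight R (D y) f) = 0 := by
      rw [← Module.End.mul_apply, (hcomm.pow_left _).eq, Module.End.mul_apply, hf, map_zero]
    rw [pow_succ, Module.End.mul_apply, Derivation.coeFn_coe, hleib, map_add, hdf, add_zero]
    exact ih hf

open MvPolynomial

variable {σ : Type*} {D : Derivation R (MvPolynomial σ R) (MvPolynomial σ R)}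

lemma iSup_eigenspace_derivation_eq_top {c : σ → R} (hD : ∀ i, D (X i) = c i • X i) :
    ⨆ μ, Module.End.eigenspace (D : Module.End R (MvPolynomial σ R)) μ = ⊤ := by
  refine eq_top_iff.mpr fun f _ => ?_
  rw [f.as_sum]
  refine sum_mem fun s _ => ?_
  refine Submodule.mem_iSup_of_mem (∑ i ∈ s.support, s i * c i)
    (Module.End.mem_eigenspace_iff.mpr ?_)
  rw [monomial_eq, ← smul_eq_C_mul, map_smul, smul_comm]
  exact congrArg _ (derivation_prod_eq_smul fun i _ => derivation_pow_eq_smul (hD i) (s i))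

lemma exists_derivation_pow_eq_zero (hD : ∀ i, D (D (X i)) = 0) (f : MvPolynomial σ R) :
    ∃ k : ℕ, ((D : Module.End R (MvPolynomial σ R)) ^ k) f = 0 := by
  induction f using MvPolynomial.induction_on with
  | C a => exact ⟨1, by rw [pow_one]; exact D.map_algebraMap a⟩
  | add f g hf hg =>
    obtain ⟨k, hk⟩ := hf
    obtain ⟨l, hl⟩ := hg
    refine ⟨max k l, ?_⟩
    rw [map_add, Module.End.pow_map_zero_of_le (le_max_left k l) hk,
      Module.End.pow_map_zero_of_le (le_max_right k l) hl, add_zero]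
  | mul_X f i hf => exact hf.elim fun k hk => ⟨k + 1, derivation_pow_succ_mul_eq_zero (hD i) hk⟩

end Derivations

section MatrixPolynomials

attribute [local instance 100] LieRing.ofAssociativeRing

open MvPolynomial

section General

variable {R ι κ : Type*} [CommRing R]

variable (R ι) in
/-- The linear form `∑ u i X_{i,j}` in the `j`-th column of a matrix of variables. -/
def columnForm (j : κ) : (ι →₀ R) →ₗ[R] MvPolynomial (ι × κ) R :=
  Finsupp.linearCombination R fun i => X (i, j)

lemma columnForm_single (i : ι) (j : κ) : columnForm R ι j (Finsupp.single i 1) = X (i, j) := by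
  simp [columnForm]

variable (R ι κ) in
/-- The action of `End (R^ι)` by derivations on the polynomials in an `ι × κ` matrix of variables,
each column of variables being a copy of the standard basis of `R^ι`. -/
def columnDerivation : Module.End R (ι →₀ R) →ₗ⁅R⁆
    Derivation R (MvPolynomial (ι × κ) R) (MvPolynomial (ι × κ) R) where
  toFun x := mkDerivation R fun p => columnForm R ι p.2 (x (Finsupp.single p.1 1))
  map_add' x y := derivation_ext fun p => by simp [mkDerivation_X]
  map_smul' c x := derivation_ext fun p => by simp [mkDerivation_X]
  map_lie' {x y} := by
    have hform (x : Module.End R (ι →₀ R)) (j : κ) (u : ι →₀ R) :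
        mkDerivation R (fun p : ι × κ => columnForm R ι p.2 (x (Finsupp.single p.1 1)))
          (columnForm R ι j u) = columnForm R ι j (x u) := by
      induction u using Finsupp.induction_linear with
      | zero => simp
      | add u v hu hv => simp only [map_add, hu, hv]
      | single i c =>
        rw [← mul_one c, ← smul_eq_mul, ← Finsupp.smul_single]
        simp only [map_smul, Derivation.map_smul, columnForm_single, mkDerivation_X]
    refine derivation_ext fun p => ?_
    simp only [Derivation.commutator_apply, mkDerivation_X, hform, ← map_sub]
    rfl

lemma columnDerivation_X (x : Module.End R (ι →₀ R)) (i : ι) (j : κ) :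
    columnDerivation R ι κ x (X (i, j)) = columnForm R ι j (x (Finsupp.single i 1)) :=
  mkDerivation_X _ _ _

end General

/-- Polynomials in a doubly infinite matrix of variables, in which highest weight vectors of all
weights in `P_+(S)` are found among the products of minors. -/
abbrev MatPoly : Type := MvPolynomial (ℤ × ℤ) ℂ

instance : LieRingModule glInf MatPoly :=
  LieRingModule.compLieHom MatPoly ((columnDerivation ℂ ℤ ℤ).comp glInf.incl)

instance : LieModule ℂ glInf MatPoly :=
  LieModule.compLieHom MatPoly ((columnDerivation ℂ ℤ ℤ).comp glInf.incl)

lemma lie_matPoly (x : glInf) (f : MatPoly) : ⁅x, f⁆ = columnDerivation ℂ ℤ ℤ x f := rfl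

lemma columnDerivation_E_X (m n i j : ℤ) :
    columnDerivation ℂ ℤ ℤ (E m n) (X (i, j)) = if i = n then X (m, j) else 0 := by
  rw [columnDerivation_X]
  change columnForm ℂ ℤ j (matUnit m n (Finsupp.single i 1)) = _
  by_cases h : i = n <;> simp [matUnit, h, columnForm_single]

lemma inCint_matPoly : InCint MatPoly where
  inC f := by
    refine ⟨f.vars.image Prod.fst, fun m n hn => derivation_eq_zero_of_forall_mem_vars
      (D := columnDerivation ℂ ℤ ℤ (E m n)) ?_⟩
    rintro ⟨i, j⟩ hij
    exact (columnDerivation_E_X m n i j).trans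
      (if_neg fun h : i = n => hn (h ▸ Finset.mem_image_of_mem Prod.fst hij))
  integrable.semisimple n := by
    refine iSup_eigenspace_derivation_eq_top (D := columnDerivation ℂ ℤ ℤ (E n n))
      (c := fun p => if p.1 = n then 1 else 0) fun ⟨i, j⟩ => (columnDerivation_E_X n n i j).trans ?_
    by_cases h : i = n <;> simp [h]
  integrable.locallyNilpotent p q hpq := by
    refine exists_derivation_pow_eq_zero (D := columnDerivation ℂ ℤ ℤ (E p q)) fun ⟨i, j⟩ => ?_
    rw [columnDerivation_E_X, apply_ite (columnDerivation ℂ ℤ ℤ (E p q)), columnDerivation_E_X,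
      if_neg hpq, map_zero, ite_self]

section Minors

variable {T : Finset ℤ} {m n : ℤ}

/-- The principal minor with rows and columns `T` of the generic doubly infinite matrix. -/
def principalMinor (T : Finset ℤ) : MatPoly :=
  ((Matrix.mvPolynomialX ℤ ℤ ℂ).submatrix ((↑) : T → ℤ) ((↑) : T → ℤ)).det

lemma principalMinor_ne_zero (T : Finset ℤ) : principalMinor T ≠ 0 := by
  intro h
  have heval : eval (fun p : ℤ × ℤ => (1 : Matrix ℤ ℤ ℂ) p.1 p.2) (principalMinor T) = 1 := by
    rw [principalMinor, RingHom.map_det, ← Matrix.det_one (n := T)]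
    congr 1
    ext p q
    simp [Matrix.one_apply]
  rw [h, map_zero] at heval
  exact zero_ne_one heval

lemma lie_E_principalMinor_of_notMem (hn : n ∉ T) : ⁅E m n, principalMinor T⁆ = 0 := by
  rw [lie_matPoly, principalMinor, derivation_det]
  refine Finset.sum_eq_zero fun p _ => Matrix.det_eq_zero_of_row_eq_zero p fun q => ?_
  rw [Matrix.updateRow_self]
  exact (columnDerivation_E_X m n p q).trans (if_neg fun h : p = n => hn (h ▸ p.2))

lemma lie_E_principalMinor (hm : m ∈ T) (hn : n ∈ T) :
    ⁅E m n, principalMinor T⁆ = if m = n then principalMinor T else 0 := by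
  set B := (Matrix.mvPolynomialX ℤ ℤ ℂ).submatrix ((↑) : T → ℤ) ((↑) : T → ℤ) with hB
  have hlie : ⁅E m n, B.det⁆ = (B.updateRow ⟨n, hn⟩ (B ⟨m, hm⟩)).det := by
    rw [lie_matPoly, derivation_det, Finset.sum_eq_single ⟨n, hn⟩ (fun p _ hp => ?_) (by simp)]
    · congr 2
      funext q
      exact (columnDerivation_E_X _ _ _ _).trans (if_pos rfl)
    · refine Matrix.det_eq_zero_of_row_eq_zero p fun q => ?_
      rw [Matrix.updateRow_self]
      exact (columnDerivation_E_X _ _ _ _).trans (if_neg fun h => hp (Subtype.ext h))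
  rw [principalMinor, ← hB, hlie]
  split_ifs with h
  · subst h
    rw [Matrix.updateRow_eq_self]
  · exact Matrix.det_updateRow_eq_zero fun h' => h (congrArg Subtype.val h')

end Minors

/-- The product of powers of the leading principal minors of the block with rows and columns
`r, …, n` that has weight `a`; the exponents are truncated differences. -/
def minorProduct (r n : ℤ) (a : ℤ → ℕ) : MatPoly :=
  ∏ i ∈ Finset.Icc r n, principalMinor (Finset.Icc r i) ^ (a i - a (i + 1))

section MinorProduct

variable {r n : ℤ} {a : ℤ → ℕ}

lemma minorProduct_ne_zero : minorProduct r n a ≠ 0 :=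
  Finset.prod_ne_zero_iff.mpr fun _ _ => pow_ne_zero _ (principalMinor_ne_zero _)

lemma lie_minorProduct_eq_smul {x : glInf} {c : ℤ → ℂ} (h : ∀ i ∈ Finset.Icc r n,
      ⁅x, principalMinor (Finset.Icc r i)⁆ = c i • principalMinor (Finset.Icc r i)) :
    ⁅x, minorProduct r n a⁆ =
      (∑ i ∈ Finset.Icc r n, ((a i - a (i + 1) : ℕ) : ℂ) * c i) • minorProduct r n a :=
  derivation_prod_eq_smul fun i hi => derivation_pow_eq_smul (h i hi) _

lemma lie_minorProduct_eq_zero {x : glInf}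
    (h : ∀ i ∈ Finset.Icc r n, ⁅x, principalMinor (Finset.Icc r i)⁆ = 0) :
    ⁅x, minorProduct r n a⁆ = 0 := by
  have hsmul := lie_minorProduct_eq_smul (a := a) (c := 0) fun i hi =>
    (h i hi).trans (zero_smul ℂ _).symm
  simpa only [Pi.zero_apply, mul_zero, Finset.sum_const_zero, zero_smul] using hsmul

lemma minorProduct_mem_vacuum : minorProduct r n a ∈ vacuum (Finset.Icc r n) MatPoly :=
  mem_vacuum_iff.mpr fun _ _ hq => lie_minorProduct_eq_zero fun _ hi =>
    lie_E_principalMinor_of_notMem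
      (mt (fun h => Finset.Icc_subset_Icc_right (Finset.mem_Icc.mp hi).2 h) hq)

lemma lie_E_minorProduct_of_lt {p q : ℤ} (hp : r ≤ p) (hpq : p < q) :
    ⁅E p q, minorProduct r n a⁆ = 0 := by
  refine lie_minorProduct_eq_zero fun i _ => ?_
  by_cases hq : q ∈ Finset.Icc r i
  · have hpi : p ∈ Finset.Icc r i :=
      Finset.mem_Icc.mpr ⟨hp, hpq.le.trans (Finset.mem_Icc.mp hq).2⟩
    rw [lie_E_principalMinor hpi hq, if_neg hpq.ne]
  · exact lie_E_principalMinor_of_notMem hq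

lemma sum_Icc_int_sub {G : Type*} [AddCommGroup G] (f : ℤ → G) {k n : ℤ} (hkn : k ≤ n) :
    ∑ i ∈ Finset.Icc k n, (f i - f (i + 1)) = f k - f (n + 1) := by
  induction n, hkn using Int.leInduction with
  | base => simp
  | succ n hkn ih =>
    rw [← Finset.insert_Icc_right_eq_Icc_add_one (by omega), Finset.sum_insert (by simp), ih]
    abel

lemma lie_E_self_minorProduct (ha : ∀ i ∈ Finset.Icc r n, a (i + 1) ≤ a i) (han : a (n + 1) = 0)
    {k : ℤ} (hk : k ∈ Finset.Icc r n) :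
    ⁅E k k, minorProduct r n a⁆ = (a k : ℂ) • minorProduct r n a := by
  have hminor (i : ℤ) : ⁅E k k, principalMinor (Finset.Icc r i)⁆ =
      (if k ∈ Finset.Icc r i then 1 else 0 : ℂ) • principalMinor (Finset.Icc r i) := by
    split_ifs with hki
    · rw [lie_E_principalMinor hki hki, if_pos rfl, one_smul]
    · rw [lie_E_principalMinor_of_notMem hki, zero_smul]
  have hfilter : (Finset.Icc r n).filter (k ∈ Finset.Icc r ·) = Finset.Icc k n := by
    ext i
    simp only [Finset.mem_Icc, Finset.mem_filter] at *
    omega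
  rw [lie_minorProduct_eq_smul fun i _ => hminor i]
  congr 1
  calc ∑ i ∈ Finset.Icc r n, ((a i - a (i + 1) : ℕ) : ℂ) * (if k ∈ Finset.Icc r i then 1 else 0)
      = ∑ i ∈ Finset.Icc k n, ((a i - a (i + 1) : ℕ) : ℂ) := by
        simp only [mul_ite, mul_one, mul_zero, ← Finset.sum_filter, hfilter]
    _ = ∑ i ∈ Finset.Icc k n, ((a i : ℂ) - a (i + 1)) := Finset.sum_congr rfl fun i hi =>
        Nat.cast_sub (ha i (Finset.Icc_subset_Icc_left (Finset.mem_Icc.mp hk).1 hi))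
    _ = a k := by
        rw [sum_Icc_int_sub (fun i => (a i : ℂ)) (Finset.mem_Icc.mp hk).2, han, Nat.cast_zero,
          sub_zero]

lemma exists_isHighestWeight_matPoly {lam : Module.Dual ℂ H} (hlam : lam ∈ PPlus (Finset.Icc r n)) :
    ∃ v ∈ vacuum (Finset.Icc r n) MatPoly, v ≠ 0 ∧ IsHighestWeight (Finset.Icc r n) lam v := by
  obtain ⟨a, hlam, hout, hanti⟩ := hlam
  have ha (i : ℤ) (hi : i ∈ Finset.Icc r n) : a (i + 1) ≤ a i := by
    by_cases hi' : i + 1 ∈ Finset.Icc r n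
    · exact hanti i hi _ hi' (lt_add_one i)
    · exact hout _ hi' ▸ Nat.zero_le _
  refine ⟨minorProduct r n a, minorProduct_mem_vacuum, minorProduct_ne_zero,
    fun p q hp _ hpq => lie_E_minorProduct_of_lt (Finset.mem_Icc.mp hp).1 hpq, fun i hi => ?_⟩
  rw [hlam]
  exact lie_E_self_minorProduct ha (hout _ (by simp)) hi

end MinorProduct

end MatrixPolynomials

section Subquotient

lemma lieSpan_self_eq_top {R g M : Type*} [CommRing R] [LieRing g] [AddCommGroup M] [Module R M]
    [LieRingModule g M] (v : M) : LieSubmodule.lieSpan R g {(⟨v, LieSubmodule.subset_lieSpan rfl⟩ :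
      LieSubmodule.lieSpan R g {v})} = ⊤ := by
  refine LieSubmodule.map_injective_of_injective (f := (LieSubmodule.lieSpan R g {v}).incl)
    Subtype.val_injective ?_
  rw [LieSubmodule.map_incl_top]
  refine le_antisymm LieSubmodule.map_incl_le (LieSubmodule.lieSpan_le.mpr ?_)
  exact Set.singleton_subset_iff.mpr ⟨_, LieSubmodule.subset_lieSpan rfl, rfl⟩

variable {S : Finset ℤ} {lam : Module.Dual ℂ H}
  {W : Type*} [AddCommGroup W] [Module ℂ W] [LieRingModule glInf W] [LieModule ℂ glInf W]

lemma IsHighestWeight.isIrreducible_L_and_exists_subquotient_equiv {v : W}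
    (hv : IsHighestWeight S lam v) (hvac : v ∈ vacuum S W) (hv0 : v ≠ 0) :
    LieModule.IsIrreducible ℂ glInf (L S lam) ∧
      ∃ (N : LieSubmodule ℂ glInf W) (P : LieSubmodule ℂ glInf N),
        Nonempty (L S lam ≃ₗ⁅ℂ,glInf⁆ N ⧸ P) := by
  let N := LieSubmodule.lieSpan ℂ glInf {v}
  let v' : N := ⟨v, LieSubmodule.subset_lieSpan rfl⟩
  let q := LieSubmodule.Quotient.mk' (sumProper ℂ glInf N)
  have hvac' : v' ∈ vacuum S N := fun x hx => Subtype.ext (hvac x hx)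
  have hv' : IsHighestWeight S lam v' :=
    ⟨fun _ _ hm hn h => Subtype.ext (hv.upper hm hn h), fun _ hi => Subtype.ext (hv.weight hi)⟩
  have hgen : LieSubmodule.lieSpan ℂ glInf {v'} = ⊤ := lieSpan_self_eq_top v
  obtain ⟨D, a, h⟩ := hv'.exists_isLowestDegreeGenerator hvac' hgen
  have := h.isIrreducible fun h0 => hv0 (congrArg Subtype.val h0)
  have := LieModule.nontrivial_of_isIrreducible ℂ glInf (N ⧸ sumProper ℂ glInf N)
  have hqv : q v' ≠ 0 := fun h0 => by
    obtain ⟨y, hy⟩ := exists_ne (0 : N ⧸ sumProper ℂ glInf N)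
    obtain ⟨x, rfl⟩ := LieSubmodule.Quotient.surjective_mk' _ y
    exact hy ((LieSubmodule.mem_bot _).mp
      (map_mem_of_lieSpan_eq_top hgen ((LieSubmodule.mem_bot _).mpr h0) x))
  have hqvac : q v' ∈ vacuum S (N ⧸ sumProper ℂ glInf N) := fun x hx => by
    rw [← LieModuleHom.map_lie, hvac' x hx, map_zero]
  have hq := hv'.map (q.restrictLie (glS S))
  exact ⟨hq.isIrreducible_L hqvac hqv, N, _, hq.nonempty_L_equiv hqvac hqv⟩

lemma InCint.isIrreducible_L_and_inCint_L (hW : InCint W)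
    (h : ∃ v ∈ vacuum S W, v ≠ 0 ∧ IsHighestWeight S lam v) :
    LieModule.IsIrreducible ℂ glInf (L S lam) ∧ InCint (L S lam) := by
  obtain ⟨v, hvac, hv0, hv⟩ := h
  obtain ⟨hL, N, P, ⟨e⟩⟩ := hv.isIrreducible_L_and_exists_subquotient_equiv hvac hv0
  have hN : InCint N := hW.of_injective (f := N.incl) Subtype.val_injective
  have hNP : InCint (N ⧸ P) := hN.of_surjective (LieSubmodule.Quotient.surjective_mk' P)
  exact ⟨hL, hNP.of_equiv e⟩

end Subquotient

end GlInf

end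

theorem theorem3p21 :
    (∀ r n : ℤ, r < n → ∀ lam ∈ GlInf.PPlus (Finset.Icc r n),
      LieModule.IsIrreducible ℂ GlInf.glInf (GlInf.L (Finset.Icc r n) lam) ∧
      GlInf.InCint (GlInf.L (Finset.Icc r n) lam)) ∧
    (∀ (W : Type*) [AddCommGroup W] [Module ℂ W] [LieRingModule GlInf.glInf W]
      [LieModule ℂ GlInf.glInf W],
      LieModule.IsIrreducible ℂ GlInf.glInf W → GlInf.InCint W →
      ∃ r n : ℤ, r < n ∧ ∃ lam ∈ GlInf.PPlus (Finset.Icc r n),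
        Nonempty (W ≃ₗ⁅ℂ, GlInf.glInf⁆ GlInf.L (Finset.Icc r n) lam)) := by
  refine ⟨fun r n _ lam hlam => GlInf.inCint_matPoly.isIrreducible_L_and_inCint_L
    (GlInf.exists_isHighestWeight_matPoly hlam), fun W _ _ _ _ hirr hW => ?_⟩
  have := LieModule.nontrivial_of_isIrreducible ℂ GlInf.glInf W
  obtain ⟨r, n, hrn, lam, hlam, v, hvac, hv0, hv⟩ := hW.exists_isHighestWeight
  exact ⟨r, n, hrn, lam, hlam, (hv.nonempty_L_equiv hvac hv0).map LieModuleEquiv.symm⟩
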